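/- \textbf{Theorem (Uniqueness).} Let $H$ be a separable real Hilbert space with scalar product $\langle\cdot,\cdot\rangle$ and norm $|\cdot|$, and let $A$ be a nonnegative self-adjoint (possibly unbounded) operator on $H$ with dense domain. By the spectral theorem there are a $\sigma$-finite measure space $(M,\mu)$, a measurable function $\lambda:M\to[0,+\infty)$ and a unitary operator $u\mapsto\hat u$ from $H$ onto $L^2(M,\mu)$ that turns $A$ into multiplication by $\lambda^2$ on its maximal domain (when $A$ has a countable orthonormal basis of eigenvectors $e_k$ with eigenvalues $\lambda_k^2$, this is just $\hat u=\{\langle u,e_k\rangle\}_k$, and integrals over $M$ are sums over $k$). Thus $|A^{1/2}u|^2=\int_M\lambda^{2}\hat u^2\,d\mu$. For $\varphi:[0,+\infty)\to[1,+\infty)$, $r>0$ and $\alpha\ge 0$ let $$\|u\|_{\varphi,r,\alpha}^2=\int_M\lambda^{4\alpha}\,\hat u^2\,e^{r\varphi(\lambda)}\,d\mu,\qquad \mathcal G_{\varphi,r,\alpha}(A)=\{u\in H:\ \|u\|_{\varphi,r,\alpha}<+\infty\},$$ the latter with norm $(|u|^2+\|u\|_{\varphi,r,\alpha}^2)^{1/2}$.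 Let $\omega:[0,+\infty)\to[0,+\infty)$ be a continuity modulus, that is, continuous, nondecreasing, with $\omega(0)=0$ and $\omega(a+b)\le\omega(a)+\omega(b)$ for all $a,b\ge0$. Let $m:[0,+\infty)\to[0,+\infty)$ be $\omega$-continuous, that is, for some $L\in\mathbb R$, $|m(a)-m(b)|\le L\,\omega(|a-b|)$ for all $a,b\ge 0$. Let $\varphi:[0,+\infty)\to[1,+\infty)$, and assume that for some constant $\Lambda$ either $\inf m>0$ and $$\sigma\,\omega(1/\sigma)\le\Lambda\varphi(\sigma)\qquad\forall\sigma>0,$$ or $\inf m=0$ and $$\sigma\le\Lambda\,\varphi\!\left(\frac{\sigma}{\sqrt{\omega(1/\sigma)}}\right)\qquad\forall\sigma>0.$$ Let $(u_0,u_1)\in\mathcal G_{\varphi,r_0,3/2}(A)\times\mathcal G_{\varphi,r_0,1}(A)$ for some $r_0>0$, and assume that $$\left|\langle Au_0,u_1\rangle\right|+\left||A^{1/2}u_1|^2-m(|A^{1/2}u_0|^2)\,|Au_0|^2\right|\neq0 .$$ Let $T>0$, $r_1\in(0,r_0)$, and let $v_1$, $v_2$ be two solutions of the problem $$u''(t)+m(|A^{1/2}u(t)|^2)\,Au(t)=0\quad\forall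 t\in[0,T),\qquad u(0)=u_0,\quad u'(0)=u_1,$$ in the space $$C^2([0,T];\mathcal G_{\varphi,r_1,1/2}(A))\cap C^1([0,T];\mathcal G_{\varphi,r_1,1}(A))\cap C^0([0,T];\mathcal G_{\varphi,r_1,3/2}(A)).$$ Then: \begin{enumerate} \item There exists $T_1\in(0,T]$ such that $v_1(t)=v_2(t)$ for every $t\in[0,T_1]$. \item Let $T_*$ be the supremum of all $T_1\in(0,T]$ such that $v_1=v_2$ on $[0,T_1]$. Then $v_1=v_2$ on $[0,T_*]$ and, denoting by $v$ their common value there, either $T_*=T$ or $$\left|\langle Av(T_*),v'(T_*)\rangle\right|+\left||A^{1/2}v'(T_*)|^2-m(|A^{1/2}v(T_*)|^2)\,|Av(T_*)|^2\right|=0 .$$ \end{enumerate} -/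

import Mathlib

open Set Filter Topology MeasureTheory
open scoped ENNReal

noncomputable section

namespace Kirchhoff

variable {H : Type*} [NormedAddCommGroup H] [InnerProductSpace ℝ H]

/-- A spectral representation of an (unbounded) operator `A` on `H`: a `σ`-finite measure space
`(M, μ)`, a measurable function `lam ≥ 0` and a unitary operator `U : H → L²(M, μ)` under which `A`
becomes multiplication by `lam ^ 2`, on its maximal domain.

When `H` has a countable orthonormal basis `e k` with `A (e k) = lam k ^ 2 • e k`, one may take
`M = ℕ` with the counting measure, `U u` being the sequence of components of `u`.
By the spectral theorem every nonnegative self-adjoint operator on a separable Hilbert space has a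
spectral representation. -/
structure SpectralRepresentation (A : H →ₗ.[ℝ] H) where
  M : Type
  [measurableSpace : MeasurableSpace M]
  μ : Measure M
  sigmaFinite : SigmaFinite μ
  lam : M → ℝ
  measurable_lam : Measurable lam
  lam_nonneg : ∀ ξ, 0 ≤ lam ξ
  U : H ≃ₗᵢ[ℝ] Lp ℝ 2 μ
  mem_domain_iff : ∀ u : H, u ∈ A.domain ↔ MemLp (fun ξ => lam ξ ^ 2 * U u ξ) 2 μ
  apply_eq : ∀ u : A.domain, U (A u) =ᵐ[μ] fun ξ => lam ξ ^ 2 * U (u : H) ξ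

attribute [instance] SpectralRepresentation.measurableSpace

open Classical in
/-- `∑ k, w (lam k) * (u k) ^ 2`, that is, `∫ w (lam ξ) * (U u) (ξ) ^ 2 dμ(ξ)` in a spectral
representation of `A`; it is the quadratic form `⟨w (A ^ (1/2)) u, u⟩` of the functional calculus
and does not depend on the representation. (The last line is never reached for a nonnegative
self-adjoint operator on a separable Hilbert space.) -/
def spectralIntegral (A : H →ₗ.[ℝ] H) (w : ℝ → ℝ≥0∞) (u : H) : ℝ≥0∞ :=
  if h : Nonempty (SpectralRepresentation A) then
    ∫⁻ ξ, w (h.some.lam ξ) * ENNReal.ofReal (h.some.U u ξ ^ 2) ∂h.some.μ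
  else ⊤

/-- `|A ^ α u| ^ 2`, for `u` in the domain of `A ^ α`. -/
def powNormSq (A : H →ₗ.[ℝ] H) (α : ℝ) (u : H) : ℝ :=
  (spectralIntegral A (fun l => ENNReal.ofReal (l ^ (4 * α))) u).toReal

open Classical in
/-- `A u`, for `u` in the domain of `A` (and `0` outside it). -/
def applyOp (A : H →ₗ.[ℝ] H) (u : H) : H :=
  if h : u ∈ A.domain then A ⟨u, h⟩ else 0

/-- The square of the Gevrey seminorm,
`∑ k, lam k ^ (4 * α) * (u k) ^ 2 * exp (r * φ (lam k))`. -/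
def gevreySq (A : H →ₗ.[ℝ] H) (φ : ℝ → ℝ) (r α : ℝ) (u : H) : ℝ≥0∞ :=
  spectralIntegral A (fun l => ENNReal.ofReal (l ^ (4 * α) * Real.exp (r * φ l))) u

/-- The generalized Gevrey space `G_{φ, r, α}(A)`. -/
def gevrey (A : H →ₗ.[ℝ] H) (φ : ℝ → ℝ) (r α : ℝ) : Set H :=
  {u | gevreySq A φ r α u < ⊤}

/-- The square of the norm of `G_{φ, r, α}(A)`. -/
def gevreyNormSq (A : H →ₗ.[ℝ] H) (φ : ℝ → ℝ) (r α : ℝ) (u : H) : ℝ≥0∞ :=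
  ENNReal.ofReal (‖u‖ ^ 2) + gevreySq A φ r α u

/-- `f ∈ C⁰([0, T]; G_{φ, r, α}(A))`. -/
def ContGevrey (A : H →ₗ.[ℝ] H) (φ : ℝ → ℝ) (r α T : ℝ) (f : ℝ → H) : Prop :=
  ∀ t ∈ Icc 0 T, f t ∈ gevrey A φ r α ∧
    Tendsto (fun s => gevreyNormSq A φ r α (f s - f t)) (𝓝[Icc 0 T] t) (𝓝 0)

/-- `f'` is the derivative of `f` on `[0, T]` in the norm of `G_{φ, r, α}(A)`
(one-sided at the endpoints). -/
def HasDerivGevrey (A : H →ₗ.[ℝ] H) (φ : ℝ → ℝ) (r α T : ℝ) (f f' : ℝ → H) : Prop :=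
  ∀ t ∈ Icc 0 T,
    Tendsto (fun s => gevreyNormSq A φ r α ((s - t)⁻¹ • (f s - f t) - f' t))
      (𝓝[Icc 0 T \ {t}] t) (𝓝 0)

/-- `f ∈ Cᵏ([0, T]; G_{φ, r, α}(A))`. -/
def ContDiffGevrey (A : H →ₗ.[ℝ] H) (φ : ℝ → ℝ) (r α T : ℝ) : ℕ → (ℝ → H) → Prop
  | 0, f => ContGevrey A φ r α T f
  | k + 1, f => ContGevrey A φ r α T f ∧
      ∃ f' : ℝ → H, HasDerivGevrey A φ r α T f f' ∧ ContDiffGevrey A φ r α T k f'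

/-- The space `C²([0, T]; G_{φ, r, 1/2}) ∩ C¹([0, T]; G_{φ, r, 1}) ∩ C⁰([0, T]; G_{φ, r, 3/2})`. -/
def SolutionClass (A : H →ₗ.[ℝ] H) (φ : ℝ → ℝ) (r T : ℝ) (v : ℝ → H) : Prop :=
  ContDiffGevrey A φ r (1 / 2) T 2 v ∧ ContDiffGevrey A φ r 1 T 1 v ∧
    ContDiffGevrey A φ r (3 / 2) T 0 v

/-- `v` solves `v'' + m (|A ^ (1/2) v| ^ 2) A v = 0` on `[0, T)` with `v 0 = u₀`, `v' 0 = u₁`.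
Derivatives are those of `H`-valued functions on `[0, T]`. -/
def IsSolution (A : H →ₗ.[ℝ] H) (m : ℝ → ℝ) (u₀ u₁ : H) (T : ℝ) (v : ℝ → H) : Prop :=
  (∀ t ∈ Ico 0 T,
    derivWithin (derivWithin v (Icc 0 T)) (Icc 0 T) t
      + m (powNormSq A (1 / 2) (v t)) • applyOp A (v t) = 0) ∧
  v 0 = u₀ ∧ derivWithin v (Icc 0 T) 0 = u₁

/-- `|⟨A u, w⟩| + | |A ^ (1/2) w| ^ 2 - m (|A ^ (1/2) u| ^ 2) * |A u| ^ 2 |`. -/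
def nondegeneracy (A : H →ₗ.[ℝ] H) (m : ℝ → ℝ) (u w : H) : ℝ :=
  |inner ℝ (applyOp A u) w| +
    |powNormSq A (1 / 2) w - m (powNormSq A (1 / 2) u) * ‖applyOp A u‖ ^ 2|

/-- `ω : [0, ∞) → [0, ∞)` is a continuity modulus. -/
structure IsContinuityModulus (ω : ℝ → ℝ) : Prop where
  continuousOn : ContinuousOn ω (Ici 0)
  monotoneOn : MonotoneOn ω (Ici 0)
  nonneg : ∀ a, 0 ≤ a → 0 ≤ ω a
  map_zero : ω 0 = 0
  subadditive : ∀ a b, 0 ≤ a → 0 ≤ b → ω (a + b) ≤ ω a + ω b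

/-- `m` is `ω`-continuous on `[0, ∞)`. -/
def IsOmegaContinuous (ω m : ℝ → ℝ) : Prop :=
  ∃ L : ℝ, ∀ a b, 0 ≤ a → 0 ≤ b → |m a - m b| ≤ L * ω |a - b|

/-- The infimum of `m` over `[0, ∞)`. -/
def infimum (m : ℝ → ℝ) : ℝ := sInf (m '' Ici 0)

end Kirchhoff

end

/-!
Local uniqueness for the Kirchhoff equation `u'' + m(|A^{1/2}u|²) A u = 0` cannot rest on a
Lipschitz estimate for `m`. The idea is to compare two solutions `u` and `v` not at equal times,
but at times at which `|A^{1/2}u|²` and `|A^{1/2}v|²` have the same value: then both solve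
*linear* equations with the same coefficient, and `m` disappears from the difference.

Let `ψ(t) = |A^{1/2}u(t)|²` and `χ(t) = |A^{1/2}v(t)|²`. Then `ψ' = 2⟨Au, u'⟩` and `ψ'' =
2(|A^{1/2}u'|² - m(ψ)|Au|²)`, so that the non-degeneracy assumption says exactly that `ψ'` or
`ψ''` does not vanish at the initial time. Hence `ψ` and `χ` are strictly monotone for a short
time, and `τ = χ⁻¹ ∘ ψ` is well defined. Since `ψ'² - (χ' ∘ τ)²` has derivative `2ψ'(ψ'' - χ'' ∘
τ)`, and `|χ - χ(0)| ≤ C χ'²`, one obtains `|1 - τ'| ≤ C sup |ψ'' - χ'' ∘ τ|`, even where `ψ'`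
vanishes at the initial time (`exists_time_change`). As `m(ψ) = m(χ ∘ τ)`, the right-hand side is
at most a multiple of the energy norm of `(u - v ∘ τ, u' - v' ∘ τ)` (`abs_secondDeriv_sub_le`).

Conversely, this pair solves the linear equation with coefficient `c = m ∘ ψ` and a forcing
proportional to `1 - τ'`. The coefficient has only the modulus of continuity `ω`, which costs
derivatives. The frequencies are divided into blocks, and in each block `c` is replaced in the
energy by its average over an interval of length `ε`, plus `ω(ε)` in the weakly hyperbolic case,
with `ε` depending on the block; the assumption relating `ω` and `φ` says that the resulting
growth rate is `O(φ)` (`exists_frequencyBlocks_of_pos`, `exists_frequencyBlocks_of_zero`). It is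
absorbed by an exponential weight `exp((r - Kt)φ)` that decreases in time, and if `|1 - τ'| ≤ η`
then the squared energy norm is at most `C η² t` (`energy_difference_le`).

Together, the two estimates turn the bound `η` into `η/2` for a short time, so that `τ' = 1`, and
the two solutions coincide (`SpectralSolution.exists_eqOn`). All of this takes place in the
spectral representation. The weight `φ` need not be measurable, but the argument uses only its
lower bounds on the blocks, which form a step function. Since only the regularity of the solutions
themselves enters, the local result applies at every time, which gives the alternative for the
maximal time of coincidence.
-/

namespace Kirchhoff


/-! ### Multiplication operators on `L²` -/

section Multiplication

variable {M : Type*} [MeasurableSpace M] {μ : Measure M}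

open Classical in
/-- The product of `x ∈ L²(μ)` by the function `f`, if it belongs to `L²(μ)` (and `0` otherwise).
This is the multiplication operator by `f`, possibly unbounded, extended by `0` outside its maximal
domain. -/
noncomputable def mulL2 (f : M → ℝ) (x : Lp ℝ 2 μ) : Lp ℝ 2 μ :=
  if h : MemLp (fun ξ => f ξ * x ξ) 2 μ then h.toLp _ else 0

/-- `x` belongs to the maximal domain of the multiplication by `f`. -/
def MulDom (f : M → ℝ) (x : Lp ℝ 2 μ) : Prop := MemLp (fun ξ => f ξ * x ξ) 2 μ

theorem coeFn_mulL2 {f : M → ℝ} {x : Lp ℝ 2 μ} (h : MulDom f x) :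
    mulL2 f x =ᵐ[μ] fun ξ => f ξ * x ξ := by
  have h' : MemLp (fun ξ => f ξ * x ξ) 2 μ := h
  rw [mulL2, dif_pos h']
  exact h'.coeFn_toLp

/-- Any representative of the product identifies it, and shows that `x` is in the domain. -/
theorem mulL2_eq {f : M → ℝ} {x y : Lp ℝ 2 μ} (h : y =ᵐ[μ] fun ξ => f ξ * x ξ) :
    MulDom f x ∧ mulL2 f x = y := by
  have h' : MulDom f x := (memLp_congr_ae h).1 (Lp.memLp y)
  exact ⟨h', Lp.ext ((coeFn_mulL2 h').trans h.symm)⟩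

theorem mulL2_add {f : M → ℝ} {x y : Lp ℝ 2 μ} (hx : MulDom f x) (hy : MulDom f y) :
    MulDom f (x + y) ∧ mulL2 f (x + y) = mulL2 f x + mulL2 f y := by
  apply mulL2_eq
  filter_upwards [coeFn_mulL2 hx, coeFn_mulL2 hy, Lp.coeFn_add x y,
    Lp.coeFn_add (mulL2 f x) (mulL2 f y)] with ξ h1 h2 h3 h4
  simp only [h3, h4, Pi.add_apply, h1, h2]; ring

theorem mulL2_smul {f : M → ℝ} {x : Lp ℝ 2 μ} (c : ℝ) (hx : MulDom f x) :
    MulDom f (c • x) ∧ mulL2 f (c • x) = c • mulL2 f x := by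
  apply mulL2_eq
  filter_upwards [coeFn_mulL2 hx, Lp.coeFn_smul c x, Lp.coeFn_smul c (mulL2 f x)] with ξ h1 h3 h4
  simp only [h3, h4, Pi.smul_apply, h1, smul_eq_mul]; ring

theorem mulL2_sub {f : M → ℝ} {x y : Lp ℝ 2 μ} (hx : MulDom f x) (hy : MulDom f y) :
    MulDom f (x - y) ∧ mulL2 f (x - y) = mulL2 f x - mulL2 f y := by
  apply mulL2_eq
  filter_upwards [coeFn_mulL2 hx, coeFn_mulL2 hy, Lp.coeFn_sub x y,
    Lp.coeFn_sub (mulL2 f x) (mulL2 f y)] with ξ h1 h2 h3 h4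
  simp only [h3, h4, Pi.sub_apply, h1, h2]; ring

theorem mulL2_one (x : Lp ℝ 2 μ) : MulDom (fun _ => (1 : ℝ)) x ∧ mulL2 (fun _ => (1 : ℝ)) x = x := by
  apply mulL2_eq
  simp

theorem mulL2_mulL2 {f g h : M → ℝ} {x : Lp ℝ 2 μ} (hg : MulDom g x) (hh : MulDom h x)
    (hfg : ∀ ξ, f ξ * g ξ = h ξ) :
    MulDom f (mulL2 g x) ∧ mulL2 f (mulL2 g x) = mulL2 h x := by
  apply mulL2_eq
  filter_upwards [coeFn_mulL2 hg, coeFn_mulL2 hh] with ξ h1 h2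
  rw [h1, h2, ← hfg]; ring

theorem inner_mulL2_eq {f g f' g' : M → ℝ} {x y : Lp ℝ 2 μ} (hf : MulDom f x) (hg : MulDom g y)
    (hf' : MulDom f' x) (hg' : MulDom g' y) (h : ∀ ξ, f ξ * g ξ = f' ξ * g' ξ) :
    inner ℝ (mulL2 f x) (mulL2 g y) = inner ℝ (mulL2 f' x) (mulL2 g' y) := by
  rw [L2.inner_def, L2.inner_def]
  apply integral_congr_ae
  filter_upwards [coeFn_mulL2 hf, coeFn_mulL2 hg, coeFn_mulL2 hf', coeFn_mulL2 hg']
    with ξ h1 h2 h3 h4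
  simp only [h1, h2, h3, h4, RCLike.inner_apply, conj_trivial]
  linear_combination x ξ * y ξ * h ξ

theorem norm_mulL2_sq {f : M → ℝ} {x : Lp ℝ 2 μ} (hf : MulDom f x) :
    ENNReal.ofReal (‖mulL2 f x‖ ^ 2) = ∫⁻ ξ, ENNReal.ofReal ((f ξ * x ξ) ^ 2) ∂μ := by
  rw [← real_inner_self_eq_norm_sq, L2.inner_def]
  have h1 : ∫ ξ, inner ℝ (mulL2 f x ξ) (mulL2 f x ξ) ∂μ = ∫ ξ, (f ξ * x ξ) ^ 2 ∂μ := by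
    apply integral_congr_ae
    filter_upwards [coeFn_mulL2 hf] with ξ h1
    rw [h1, real_inner_self_eq_norm_sq, Real.norm_eq_abs, sq_abs]
  rw [h1]
  exact ofReal_integral_eq_lintegral_ofReal (MemLp.integrable_sq hf)
    (Eventually.of_forall fun ξ => sq_nonneg _)

theorem mulDom_of_lintegral_lt_top {f : M → ℝ} (hf : Measurable f) {x : Lp ℝ 2 μ}
    (h : ∫⁻ ξ, ENNReal.ofReal ((f ξ * x ξ) ^ 2) ∂μ < ∞) : MulDom f x := by
  have hm : AEStronglyMeasurable (fun ξ => f ξ * x ξ) μ :=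
    hf.aestronglyMeasurable.mul (Lp.aestronglyMeasurable x)
  refine (memLp_two_iff_integrable_sq hm).2 ⟨hm.pow 2, ?_⟩
  rwa [hasFiniteIntegral_iff_ofReal (Eventually.of_forall fun ξ => sq_nonneg _)]

/-- Comparison of multiplication operators: `|f| ≤ a |g| + b` pointwise. -/
theorem norm_mulL2_le_of_abs_le {f g : M → ℝ} {x : Lp ℝ 2 μ} {a b : ℝ} (hf : Measurable f)
    (ha : 0 ≤ a) (hb : 0 ≤ b) (hg : MulDom g x) (h : ∀ ξ, |f ξ| ≤ a * |g ξ| + b) :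
    MulDom f x ∧ ‖mulL2 f x‖ ≤ a * ‖mulL2 g x‖ + b * ‖x‖ := by
  have hm : AEStronglyMeasurable (fun ξ => f ξ * x ξ) μ :=
    hf.aestronglyMeasurable.mul (Lp.aestronglyMeasurable x)
  have hF : MemLp (fun ξ => a * ‖mulL2 g x ξ‖ + b * ‖x ξ‖) 2 μ :=
    ((Lp.memLp (mulL2 g x)).norm.const_mul a).add ((Lp.memLp x).norm.const_mul b)
  have hle : ∀ᵐ ξ ∂μ, ‖f ξ * x ξ‖ ≤ a * ‖mulL2 g x ξ‖ + b * ‖x ξ‖ := by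
    filter_upwards [coeFn_mulL2 hg] with ξ h1
    rw [h1, norm_mul, norm_mul]
    have := mul_le_mul_of_nonneg_right (h ξ) (norm_nonneg (x ξ))
    simp only [Real.norm_eq_abs] at *
    linarith
  have hd : MulDom f x := hF.of_le hm (by
    filter_upwards [hle] with ξ h1
    exact h1.trans (le_abs_self _))
  refine ⟨hd, ?_⟩
  have e1 : ‖mulL2 f x‖ ≤ ‖hF.toLp _‖ := by
    apply Lp.norm_le_norm_of_ae_le
    filter_upwards [hle, coeFn_mulL2 hd, hF.coeFn_toLp] with ξ h1 h2 h3
    rw [h2, h3]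
    exact h1.trans (le_abs_self _)
  have e2 : hF.toLp _ = a • (Lp.memLp (mulL2 g x)).norm.toLp _ + b • (Lp.memLp x).norm.toLp _ := by
    rfl
  refine e1.trans ?_
  rw [e2]
  refine (norm_add_le _ _).trans ?_
  rw [norm_smul, norm_smul, Real.norm_of_nonneg ha, Real.norm_of_nonneg hb]
  have e3 : ∀ y : Lp ℝ 2 μ, ‖(Lp.memLp y).norm.toLp _‖ = ‖y‖ := fun y => by
    rw [Lp.norm_toLp, eLpNorm_norm, Lp.norm_def]
  rw [e3, e3]

theorem mulDom_of_abs_le {f : M → ℝ} (hf : Measurable f) {b : ℝ} (h : ∀ ξ, |f ξ| ≤ b)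
    (x : Lp ℝ 2 μ) : MulDom f x := by
  refine (norm_mulL2_le_of_abs_le hf zero_le_one
    (b := |b|) (abs_nonneg b) (mulL2_one x).1 fun ξ => ?_).1
  have := (h ξ).trans (le_abs_self b)
  simp only [abs_one]
  linarith

theorem norm_mulL2_le {f : M → ℝ} (hf : Measurable f) {b : ℝ} (hb : 0 ≤ b) (h : ∀ ξ, |f ξ| ≤ b)
    (x : Lp ℝ 2 μ) : ‖mulL2 f x‖ ≤ b * ‖x‖ := by
  have := (norm_mulL2_le_of_abs_le (x := x) hf (a := 0) le_rfl hb (mulL2_one x).1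
    (fun ξ => by simpa using h ξ)).2
  simpa using this

/-- Multiplication by a bounded measurable function, as a bounded operator on `L²`. -/
noncomputable def mulCLM (f : M → ℝ) (hf : Measurable f) (b : ℝ) (hb : 0 ≤ b)
    (h : ∀ ξ, |f ξ| ≤ b) : Lp ℝ 2 μ →L[ℝ] Lp ℝ 2 μ :=
  LinearMap.mkContinuous
    { toFun := mulL2 f
      map_add' := fun x y => (mulL2_add (mulDom_of_abs_le hf h x) (mulDom_of_abs_le hf h y)).2
      map_smul' := fun c x => (mulL2_smul c (mulDom_of_abs_le hf h x)).2 }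
    b (norm_mulL2_le hf hb h)

/-- Parseval's identity for the orthogonal decomposition of `L²` given by the level sets of a
measurable function `κ : M → ℕ`. -/
theorem hasSum_norm_mulL2_indicator {κ : M → ℕ} (hκ : Measurable κ) (x : Lp ℝ 2 μ) :
    HasSum (fun k => ‖mulL2 ((κ ⁻¹' {k}).indicator 1) x‖ ^ 2) (‖x‖ ^ 2) := by
  have hs : ∀ k, MeasurableSet (κ ⁻¹' {k}) := fun k => hκ (measurableSet_singleton k)
  have hd : ∀ k, MulDom ((κ ⁻¹' {k}).indicator 1) x := fun k => by
    refine mulDom_of_abs_le (measurable_one.indicator (hs k)) (b := 1) (fun ξ => ?_) x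
    by_cases h : ξ ∈ κ ⁻¹' {k} <;> simp [h]
  have hint : Integrable (fun ξ => x ξ ^ 2) μ := (Lp.memLp x).integrable_sq
  have key := hasSum_integral_iUnion (μ := μ) (f := fun ξ => x ξ ^ 2) hs
    (fun i j hij => by
      refine Set.disjoint_left.2 fun ξ hi hj => hij ?_
      simp only [mem_preimage, mem_singleton_iff] at hi hj
      rw [← hi, ← hj]) hint.integrableOn
  have hU : (⋃ k, κ ⁻¹' {k}) = univ := by
    ext ξ; simp
  rw [hU, setIntegral_univ] at key
  have hx : ∀ y : Lp ℝ 2 μ, ‖y‖ ^ 2 = ∫ ξ, y ξ ^ 2 ∂μ := fun y => by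
    rw [← real_inner_self_eq_norm_sq, L2.inner_def]
    simp only [real_inner_self_eq_norm_sq, Real.norm_eq_abs, sq_abs]
  rw [hx x]
  refine key.congr_fun fun k => ?_
  rw [hx, ← integral_indicator (hs k)]
  apply integral_congr_ae
  filter_upwards [coeFn_mulL2 (hd k)] with ξ h1
  rw [h1]
  by_cases h : ξ ∈ κ ⁻¹' {k}
  · simp [indicator_of_mem h]
  · simp [indicator_of_notMem h]

end Multiplication


/-! ### Comparison of time scales -/

/-- The mean value inequality, with derivatives in the open interval only. -/
theorem image_sub_le_of_hasDerivAt_le {f f' : ℝ → ℝ} {s t C : ℝ} (hst : s ≤ t)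
    (hf : ContinuousOn f (Icc s t)) (hf' : ∀ r ∈ Ioo s t, HasDerivAt f (f' r) r)
    (hC : ∀ r ∈ Ioo s t, f' r ≤ C) : f t - f s ≤ C * (t - s) := by
  refine (convex_Icc s t).image_sub_le_mul_sub_of_deriv_le hf ?_ ?_ s (left_mem_Icc.2 hst) t
    (right_mem_Icc.2 hst) hst
  · rw [interior_Icc]
    exact fun r hr => (hf' r hr).differentiableAt.differentiableWithinAt
  · rw [interior_Icc]
    intro r hr
    rw [(hf' r hr).deriv]
    exact hC r hr

/-- If `f` leaves the value `f 0` with `f' 0 > 0`, or with `f' 0 = 0` and `f'' 0 > 0`, then the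
increment of `f` is controlled by the square of its derivative. -/
theorem exists_increment_le_deriv_sq {a : ℝ} (ha : 0 < a) {f f₁ f₂ : ℝ → ℝ}
    (hf : ∀ t ∈ Icc 0 a, HasDerivWithinAt f (f₁ t) (Icc 0 a) t)
    (hf₁ : ∀ t ∈ Icc 0 a, HasDerivWithinAt f₁ (f₂ t) (Icc 0 a) t)
    (hf₂ : ContinuousOn f₂ (Icc 0 a)) (hpos : 0 < f₁ 0 ∨ f₁ 0 = 0 ∧ 0 < f₂ 0) :
    ∃ b ∈ Ioc 0 a, ∃ C, 0 ≤ C ∧ ∀ t ∈ Ioc 0 b, 0 < f₁ t ∧ f t - f 0 ≤ C * f₁ t ^ 2 := by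
  have h0 : (0 : ℝ) ∈ Icc 0 a := left_mem_Icc.2 ha.le
  have hloc : ∀ {P : ℝ → Prop}, (∀ᶠ t in 𝓝[Icc 0 a] 0, P t) → ∃ b ∈ Ioc 0 a, ∀ t ∈ Icc 0 b, P t := by
    intro P hP
    obtain ⟨ε, hε, h⟩ := Metric.mem_nhdsWithin_iff.1 hP
    refine ⟨min a (ε / 2), ⟨by positivity, min_le_left _ _⟩, fun t ht => h ⟨?_, ht.1, ?_⟩⟩
    · rw [Metric.mem_ball, Real.dist_eq, sub_zero, abs_of_nonneg ht.1]
      have := ht.2.trans (min_le_right a (ε / 2))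
      linarith
    · exact ht.2.trans (min_le_left _ _)
  rcases hpos with h1 | ⟨h1, h2⟩
  · have e1 : ∀ᶠ t in 𝓝[Icc 0 a] 0, f₁ 0 / 2 < f₁ t :=
      (hf₁ 0 h0).continuousWithinAt.eventually_const_lt (by linarith)
    have e2 : ∀ᶠ t in 𝓝[Icc 0 a] 0, f t < f 0 + 1 :=
      (hf 0 h0).continuousWithinAt.eventually_lt_const (by linarith)
    obtain ⟨b, hb, h⟩ := hloc (e1.and e2)
    refine ⟨b, hb, ((f₁ 0 / 2) ^ 2)⁻¹, by positivity, fun t ht => ?_⟩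
    obtain ⟨h3, h4⟩ := h t ⟨ht.1.le, ht.2⟩
    refine ⟨by linarith, ?_⟩
    rw [inv_mul_eq_div, le_div_iff₀ (by positivity)]
    have h5 : (f₁ 0 / 2) ^ 2 ≤ f₁ t ^ 2 := pow_le_pow_left₀ (by linarith) h3.le 2
    nlinarith [sq_nonneg (f₁ 0 / 2)]
  -- `f'' ≥ f'' 0 / 2` near `0`, hence `f' > 0` and `f'² - f'' 0 * f` is nondecreasing
  · have e1 : ∀ᶠ t in 𝓝[Icc 0 a] 0, f₂ 0 / 2 < f₂ t :=
      (hf₂ 0 h0).eventually_const_lt (by linarith)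
    obtain ⟨b, hb, h⟩ := hloc e1
    have hba : Icc 0 b ⊆ Icc 0 a := Icc_subset_Icc_right hb.2
    have hd : ∀ {g g' : ℝ → ℝ}, (∀ t ∈ Icc 0 a, HasDerivWithinAt g (g' t) (Icc 0 a) t) →
        ∀ t ∈ Ioo 0 b, HasDerivAt g (g' t) t := fun hg t ht =>
      (hg t (hba (Ioo_subset_Icc_self ht))).hasDerivAt
        (Icc_mem_nhds ht.1 (ht.2.trans_le hb.2))
    have hc : ∀ {g g' : ℝ → ℝ}, (∀ t ∈ Icc 0 a, HasDerivWithinAt g (g' t) (Icc 0 a) t) →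
        ContinuousOn g (Icc 0 a) := fun hg t ht => (hg t ht).continuousWithinAt
    have hf1pos : ∀ t ∈ Ioc 0 b, 0 < f₁ t := fun t ht => by
      have hs : Icc 0 t ⊆ Icc 0 b := Icc_subset_Icc_right ht.2
      have := image_sub_le_of_hasDerivAt_le (f := fun t => - f₁ t) (f' := fun t => -f₂ t)
        (C := -(f₂ 0 / 2)) ht.1.le ((hc hf₁).mono (hs.trans hba)).neg
        (fun r hr => (hd hf₁ r ⟨hr.1, hr.2.trans_le ht.2⟩).neg)
        (fun r hr => by
          have := h r ⟨hr.1.le, hr.2.le.trans ht.2⟩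
          linarith)
      have := mul_pos h2 ht.1
      linarith
    refine ⟨b, hb, (f₂ 0)⁻¹, by positivity, fun t ht => ⟨hf1pos t ht, ?_⟩⟩
    have hs : Icc 0 t ⊆ Icc 0 b := Icc_subset_Icc_right ht.2
    have := image_sub_le_of_hasDerivAt_le (f := fun t => f₂ 0 * f t - f₁ t ^ 2)
      (f' := fun t => f₂ 0 * f₁ t - 2 * f₁ t * f₂ t)
      (C := 0) ht.1.le
      (((hc hf).const_mul (f₂ 0)).sub ((hc hf₁).pow 2) |>.mono (hs.trans hba))
      (fun r hr => by
        have hr' : r ∈ Ioo 0 b := ⟨hr.1, hr.2.trans_le ht.2⟩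
        have := ((hd hf r hr').const_mul (f₂ 0)).sub ((hd hf₁ r hr').pow 2)
        refine this.congr_deriv ?_
        simp)
      (fun r hr => by
        have h3 := h r ⟨hr.1.le, hr.2.le.trans ht.2⟩
        have h4 := hf1pos r ⟨hr.1, hr.2.le.trans ht.2⟩
        nlinarith)
    rw [inv_mul_eq_div, le_div_iff₀ h2]
    simp only [h1] at this
    linarith

/-- The case of increasing `ψ` in `exists_time_change`. -/
theorem exists_time_change_of_pos {a : ℝ} (ha : 0 < a) {ψ ψ₁ ψ₂ χ χ₁ χ₂ : ℝ → ℝ}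
    (hψ : ∀ t ∈ Icc 0 a, HasDerivWithinAt ψ (ψ₁ t) (Icc 0 a) t)
    (hψ₁ : ∀ t ∈ Icc 0 a, HasDerivWithinAt ψ₁ (ψ₂ t) (Icc 0 a) t)
    (hψ₂ : ContinuousOn ψ₂ (Icc 0 a))
    (hχ : ∀ t ∈ Icc 0 a, HasDerivWithinAt χ (χ₁ t) (Icc 0 a) t)
    (hχ₁ : ∀ t ∈ Icc 0 a, HasDerivWithinAt χ₁ (χ₂ t) (Icc 0 a) t)
    (hχ₂ : ContinuousOn χ₂ (Icc 0 a))
    (h0 : χ 0 = ψ 0) (h1 : χ₁ 0 = ψ₁ 0) (h2 : χ₂ 0 = ψ₂ 0)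
    (hpos : 0 < ψ₁ 0 ∨ ψ₁ 0 = 0 ∧ 0 < ψ₂ 0) :
    ∃ δ ∈ Ioc 0 a, ∃ τ : ℝ → ℝ, ∃ C, 0 ≤ C ∧ τ 0 = 0 ∧ ContinuousOn τ (Icc 0 δ) ∧
      (∀ t ∈ Icc 0 δ, τ t ∈ Icc 0 a ∧ χ (τ t) = ψ t) ∧
      (∀ t ∈ Ioo 0 δ, τ t ∈ Ioo 0 a ∧ HasDerivAt τ (ψ₁ t / χ₁ (τ t)) t) ∧
      ∀ t ∈ Ioo 0 δ, ∀ B, (∀ s ∈ Ioo 0 t, |ψ₂ s - χ₂ (τ s)| ≤ B) →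
        |1 - ψ₁ t / χ₁ (τ t)| ≤ C * B := by
  obtain ⟨b₁, hb₁, C₁, -, H₁⟩ := exists_increment_le_deriv_sq ha hψ hψ₁ hψ₂ hpos
  obtain ⟨b₂, hb₂, C, hC, H₂⟩ := exists_increment_le_deriv_sq ha hχ hχ₁ hχ₂ (by rwa [h1, h2])
  set b := min b₁ b₂ with hb
  have hb0 : 0 < b := lt_min hb₁.1 hb₂.1
  have hba : b ≤ a := (min_le_left _ _).trans hb₁.2
  have hsub : Icc 0 b ⊆ Icc 0 a := Icc_subset_Icc_right hba
  have hψpos : ∀ t ∈ Ioc 0 b, 0 < ψ₁ t := fun t ht =>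
    (H₁ t ⟨ht.1, ht.2.trans (min_le_left _ _)⟩).1
  have hχpos : ∀ t ∈ Ioc 0 b, 0 < χ₁ t ∧ χ t - χ 0 ≤ C * χ₁ t ^ 2 := fun t ht =>
    H₂ t ⟨ht.1, ht.2.trans (min_le_right _ _)⟩
  have hd : ∀ {g g' : ℝ → ℝ}, (∀ t ∈ Icc 0 a, HasDerivWithinAt g (g' t) (Icc 0 a) t) →
      ∀ t ∈ Ioo 0 b, HasDerivAt g (g' t) t := fun hg t ht =>
    (hg t (hsub (Ioo_subset_Icc_self ht))).hasDerivAt (Icc_mem_nhds ht.1 (ht.2.trans_le hba))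
  have hc : ∀ {g g' : ℝ → ℝ}, (∀ t ∈ Icc 0 a, HasDerivWithinAt g (g' t) (Icc 0 a) t) →
      ContinuousOn g (Icc 0 a) := fun hg t ht => (hg t ht).continuousWithinAt
  have hmono : ∀ {g g' : ℝ → ℝ}, (∀ t ∈ Icc 0 a, HasDerivWithinAt g (g' t) (Icc 0 a) t) →
      (∀ t ∈ Ioc 0 b, 0 < g' t) → StrictMonoOn g (Icc 0 b) := fun hg hp => by
    refine strictMonoOn_of_deriv_pos (convex_Icc 0 b) ((hc hg).mono hsub) fun t ht => ?_
    rw [interior_Icc] at ht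
    rw [(hd hg t ht).deriv]
    exact hp t ⟨ht.1, ht.2.le⟩
  have mψ : StrictMonoOn ψ (Icc 0 b) := hmono hψ hψpos
  have mχ : StrictMonoOn χ (Icc 0 b) := hmono hχ fun t ht => (hχpos t ht).1
  have hz : (0 : ℝ) ∈ Icc 0 b := left_mem_Icc.2 hb0.le
  have hbb : b ∈ Icc 0 b := right_mem_Icc.2 hb0.le
  obtain ⟨δ, hδ, hδψ⟩ : ∃ δ ∈ Ioc 0 b, ∀ t ∈ Icc 0 δ, ψ t < χ b := by
    have e : ∀ᶠ t in 𝓝[Icc 0 b] 0, ψ t < χ b :=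
      (((hc hψ).mono hsub) 0 hz).eventually_lt_const (by rw [← h0]; exact mχ hz hbb hb0)
    obtain ⟨ε, hε, h⟩ := Metric.mem_nhdsWithin_iff.1 e
    refine ⟨min b (ε / 2), ⟨by positivity, min_le_left _ _⟩, fun t ht => h ⟨?_, ht.1, ?_⟩⟩
    · rw [Metric.mem_ball, Real.dist_eq, sub_zero, abs_of_nonneg ht.1]
      have := ht.2.trans (min_le_right b (ε / 2))
      linarith
    · exact ht.2.trans (min_le_left _ _)
  have hδb : Icc 0 δ ⊆ Icc 0 b := Icc_subset_Icc_right hδ.2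
  have hex : ∀ t, ∃ s, t ∈ Icc 0 δ → s ∈ Icc 0 b ∧ χ s = ψ t := by
    intro t
    by_cases ht : t ∈ Icc 0 δ
    · have : ψ t ∈ Icc (χ 0) (χ b) :=
        ⟨by rw [h0]; exact mψ.monotoneOn hz (hδb ht) ht.1, (hδψ t ht).le⟩
      obtain ⟨s, hs, e⟩ := intermediate_value_Icc hb0.le ((hc hχ).mono hsub) this
      exact ⟨s, fun _ => ⟨hs, e⟩⟩
    · exact ⟨0, fun h => absurd h ht⟩
  choose τ hτ using hex
  have hτ0 : τ 0 = 0 := by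
    have hz' : (0 : ℝ) ∈ Icc 0 δ := left_mem_Icc.2 hδ.1.le
    exact mχ.injOn (hτ 0 hz').1 hz (by rw [(hτ 0 hz').2, h0])
  have hτc : ContinuousOn τ (Icc 0 δ) := by
    -- `χ` is a homeomorphism of the compact interval `[0, b]` onto its image
    have hemb : IsEmbedding (fun s : Icc 0 b => χ s) :=
      (Continuous.isClosedEmbedding (continuousOn_iff_continuous_domRestrict.1 ((hc hχ).mono hsub))
        (fun x y hxy => Subtype.ext (mχ.injOn x.2 y.2 hxy))).isEmbedding
    have : Continuous (fun t : Icc 0 δ => (⟨τ t, (hτ t t.2).1⟩ : Icc 0 b)) := by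
      rw [hemb.continuous_iff]
      have e : (fun s : Icc 0 b => χ s) ∘ (fun t : Icc 0 δ => (⟨τ t, (hτ t t.2).1⟩ : Icc 0 b))
          = fun t : Icc 0 δ => ψ t := by
        funext t
        exact (hτ t t.2).2
      rw [e]
      exact continuousOn_iff_continuous_domRestrict.1 ((hc hψ).mono (hδb.trans hsub))
    rw [continuousOn_iff_continuous_domRestrict]
    exact continuous_subtype_val.comp this
  have hτI : ∀ t ∈ Ioo 0 δ, τ t ∈ Ioo 0 b := fun t ht => by
    have ht' := Ioo_subset_Icc_self ht
    obtain ⟨h3, h4⟩ := hτ t ht'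
    refine ⟨lt_of_le_of_ne h3.1 fun h => ?_, lt_of_le_of_ne h3.2 fun h => ?_⟩
    · have := mψ hz (hδb ht') ht.1
      rw [← h4, ← h, h0] at this
      exact lt_irrefl _ this
    · have := hδψ t ht'
      rw [← h4, h] at this
      exact lt_irrefl _ this
  have hτd : ∀ t ∈ Ioo 0 δ, HasDerivAt τ (ψ₁ t / χ₁ (τ t)) t := fun t ht => by
    have hI := hτI t ht
    have hnt : Icc 0 δ ∈ 𝓝 t := Icc_mem_nhds ht.1 ht.2
    exact HasDerivAt.of_comp_left (hτc.continuousAt hnt) (hd hχ _ hI)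
      (hd hψ t ⟨ht.1, ht.2.trans_le hδ.2⟩) (hχpos _ ⟨hI.1, hI.2.le⟩).1.ne'
      (by filter_upwards [hnt] with s hs using (hτ s hs).2)
  refine ⟨δ, ⟨hδ.1, hδ.2.trans hba⟩, τ, 2 * C, by positivity, hτ0, hτc,
    fun t ht => ⟨hsub (hτ t ht).1, (hτ t ht).2⟩,
    fun t ht => ⟨⟨(hτI t ht).1, (hτI t ht).2.trans_le hba⟩, hτd t ht⟩, fun t ht B hB => ?_⟩
  -- the derivative of `ψ₁ ^ 2 - (χ₁ ∘ τ) ^ 2` is `2 * ψ₁ * (ψ₂ - χ₂ ∘ τ)`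
  have hst : Icc 0 t ⊆ Icc 0 δ := Icc_subset_Icc_right ht.2.le
  have hDc : ContinuousOn (fun s => ψ₁ s ^ 2 - χ₁ (τ s) ^ 2) (Icc 0 t) := by
    refine ContinuousOn.sub (((hc hψ₁).mono (hst.trans (hδb.trans hsub))).pow 2) (ContinuousOn.pow ?_ 2)
    exact (hc hχ₁).comp (hτc.mono hst) fun s hs => hsub (hτ s (hst hs)).1
  have hψc : ContinuousOn (fun s => (2 * B) * ψ s) (Icc 0 t) :=
    ((hc hψ).mono (hst.trans (hδb.trans hsub))).const_mul _
  have hDd : ∀ s ∈ Ioo 0 t, HasDerivAt (fun s => ψ₁ s ^ 2 - χ₁ (τ s) ^ 2)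
      (2 * ψ₁ s * (ψ₂ s - χ₂ (τ s))) s := fun s hs => by
    have hs' : s ∈ Ioo 0 δ := ⟨hs.1, hs.2.trans ht.2⟩
    have hI := hτI s hs'
    have := ((hd hψ₁ s ⟨hs.1, hs'.2.trans_le hδ.2⟩).pow 2).sub
      (((hd hχ₁ _ hI).comp s (hτd s hs')).pow 2)
    refine this.congr_deriv ?_
    have := (hχpos _ ⟨hI.1, hI.2.le⟩).1.ne'
    simp only [Function.comp]
    field_simp
    push_cast
    ring
  have hψd : ∀ s ∈ Ioo 0 t, HasDerivAt (fun s => (2 * B) * ψ s) ((2 * B) * ψ₁ s) s := fun s hs =>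
    (hd hψ s ⟨hs.1, (hs.2.trans ht.2).trans_le hδ.2⟩).const_mul _
  have hp : ∀ s ∈ Ioo 0 t, 0 < ψ₁ s := fun s hs =>
    hψpos s ⟨hs.1, (hs.2.trans ht.2).le.trans hδ.2⟩
  have k1 := image_sub_le_of_hasDerivAt_le (C := 0) ht.1.le (hDc.sub hψc)
    (fun s hs => (hDd s hs).sub (hψd s hs)) (fun s hs => by
      have := mul_le_mul_of_nonneg_left (abs_le.1 (hB s hs)).2 (hp s hs).le
      linarith)
  have k2 := image_sub_le_of_hasDerivAt_le (C := 0) ht.1.le (hDc.neg.sub hψc)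
    (fun s hs => (hDd s hs).neg.sub (hψd s hs)) (fun s hs => by
      have := mul_le_mul_of_nonneg_left (abs_le.1 (hB s hs)).1 (hp s hs).le
      linarith)
  simp only [hτ0, h1, Pi.sub_apply, Pi.neg_apply] at k1 k2
  have hB0 : 0 ≤ B := (abs_nonneg _).trans (hB (t / 2) ⟨by linarith [ht.1], by linarith [ht.1]⟩)
  have hI := hτI t ht
  obtain ⟨c1, c2⟩ := hχpos _ ⟨hI.1, hI.2.le⟩
  have c3 := hψpos t ⟨ht.1, ht.2.le.trans hδ.2⟩
  rw [(hτ t (Ioo_subset_Icc_self ht)).2, h0] at c2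
  have c4 : 2 * B * (ψ t - ψ 0) ≤ 2 * B * (C * χ₁ (τ t) ^ 2) :=
    mul_le_mul_of_nonneg_left c2 (by positivity)
  have c5 : |ψ₁ t ^ 2 - χ₁ (τ t) ^ 2| ≤ 2 * B * (C * χ₁ (τ t) ^ 2) := by
    rw [abs_le]; constructor <;> linarith
  have c6 : 1 - ψ₁ t / χ₁ (τ t) =
      -((ψ₁ t ^ 2 - χ₁ (τ t) ^ 2) / (χ₁ (τ t) * (χ₁ (τ t) + ψ₁ t))) := by
    field_simp
    ring
  rw [c6, abs_neg, abs_div, abs_of_pos (a := χ₁ (τ t) * _) (by positivity),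
    div_le_iff₀ (by positivity)]
  refine c5.trans ?_
  have : 0 ≤ 2 * C * B * (χ₁ (τ t) * ψ₁ t) := by positivity
  nlinarith

/-- Two functions `ψ` and `χ` with the same second order jet at `0`, whose first or second
derivative does not vanish there, are conjugate by a change of time `τ`, and `τ'` differs from `1`
by no more than a multiple of the largest difference between the second derivatives. The case in
which `ψ' 0 = 0` costs nothing, because `ψ'² - (χ' ∘ τ)²` has derivative
`2 ψ' (ψ'' - χ'' ∘ τ)`. -/
theorem exists_time_change {a : ℝ} (ha : 0 < a) {ψ ψ₁ ψ₂ χ χ₁ χ₂ : ℝ → ℝ}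
    (hψ : ∀ t ∈ Icc 0 a, HasDerivWithinAt ψ (ψ₁ t) (Icc 0 a) t)
    (hψ₁ : ∀ t ∈ Icc 0 a, HasDerivWithinAt ψ₁ (ψ₂ t) (Icc 0 a) t)
    (hψ₂ : ContinuousOn ψ₂ (Icc 0 a))
    (hχ : ∀ t ∈ Icc 0 a, HasDerivWithinAt χ (χ₁ t) (Icc 0 a) t)
    (hχ₁ : ∀ t ∈ Icc 0 a, HasDerivWithinAt χ₁ (χ₂ t) (Icc 0 a) t)
    (hχ₂ : ContinuousOn χ₂ (Icc 0 a))
    (h0 : χ 0 = ψ 0) (h1 : χ₁ 0 = ψ₁ 0) (h2 : χ₂ 0 = ψ₂ 0)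
    (hne : ψ₁ 0 ≠ 0 ∨ ψ₂ 0 ≠ 0) :
    ∃ δ ∈ Ioc 0 a, ∃ τ : ℝ → ℝ, ∃ C, 0 ≤ C ∧ τ 0 = 0 ∧ ContinuousOn τ (Icc 0 δ) ∧
      (∀ t ∈ Icc 0 δ, τ t ∈ Icc 0 a ∧ χ (τ t) = ψ t) ∧
      (∀ t ∈ Ioo 0 δ, τ t ∈ Ioo 0 a ∧ HasDerivAt τ (ψ₁ t / χ₁ (τ t)) t) ∧
      ∀ t ∈ Ioo 0 δ, ∀ B, (∀ s ∈ Ioo 0 t, |ψ₂ s - χ₂ (τ s)| ≤ B) →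
        |1 - ψ₁ t / χ₁ (τ t)| ≤ C * B := by
  by_cases hpos : 0 < ψ₁ 0 ∨ ψ₁ 0 = 0 ∧ 0 < ψ₂ 0
  · exact exists_time_change_of_pos ha hψ hψ₁ hψ₂ hχ hχ₁ hχ₂ h0 h1 h2 hpos
  · have hneg : 0 < -ψ₁ 0 ∨ -ψ₁ 0 = 0 ∧ 0 < -ψ₂ 0 := by
      rcases lt_trichotomy (ψ₁ 0) 0 with h | h | h
      · exact Or.inl (by linarith)
      · rcases lt_trichotomy (ψ₂ 0) 0 with h' | h' | h'
        · exact Or.inr ⟨by linarith, by linarith⟩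
        · simp [h, h'] at hne
        · exact absurd (Or.inr ⟨h, h'⟩) hpos
      · exact absurd (Or.inl h) hpos
    obtain ⟨δ, hδ, τ, C, hC, k0, k1, k2, k3, k4⟩ := exists_time_change_of_pos ha
      (ψ := fun t => -ψ t) (ψ₁ := fun t => -ψ₁ t) (ψ₂ := fun t => -ψ₂ t)
      (χ := fun t => -χ t) (χ₁ := fun t => -χ₁ t) (χ₂ := fun t => -χ₂ t)
      (fun t ht => (hψ t ht).neg) (fun t ht => (hψ₁ t ht).neg) hψ₂.neg
      (fun t ht => (hχ t ht).neg) (fun t ht => (hχ₁ t ht).neg) hχ₂.neg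
      (by rw [h0]) (by rw [h1]) (by rw [h2]) hneg
    refine ⟨δ, hδ, τ, C, hC, k0, k1, fun t ht => ⟨(k2 t ht).1, neg_injective (k2 t ht).2⟩,
      fun t ht => ⟨(k3 t ht).1, ?_⟩, fun t ht B hB => ?_⟩
    · have := (k3 t ht).2
      rwa [neg_div_neg_eq] at this
    · have := k4 t ht B (fun s hs => by
        rw [neg_sub_neg, abs_sub_comm]
        exact hB s hs)
      rwa [neg_div_neg_eq] at this


/-! ### Moduli of continuity and regularized coefficients -/

theorem IsContinuityModulus.nat_mul_le {ω : ℝ → ℝ} (hω : IsContinuityModulus ω) {a : ℝ}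
    (ha : 0 ≤ a) (n : ℕ) : ω (n * a) ≤ n * ω a := by
  induction n with
  | zero => simp [hω.map_zero]
  | succ n ih =>
    have := hω.subadditive (n * a) a (by positivity) ha
    push_cast
    rw [add_mul, one_mul, add_mul, one_mul]
    linarith

theorem IsContinuityModulus.mul_le {ω : ℝ → ℝ} (hω : IsContinuityModulus ω) {c a : ℝ}
    (hc : 0 ≤ c) (ha : 0 ≤ a) : ω (c * a) ≤ (c + 1) * ω a := by
  have h1 : ω (c * a) ≤ ω (⌈c⌉₊ * a) :=
    hω.monotoneOn (mem_Ici.2 (by positivity)) (mem_Ici.2 (by positivity))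
      (mul_le_mul_of_nonneg_right (Nat.le_ceil c) ha)
  refine (h1.trans (hω.nat_mul_le ha _)).trans ?_
  exact mul_le_mul_of_nonneg_right (Nat.ceil_lt_add_one hc).le (hω.nonneg a ha)

/-- The coefficient `c` admits the modulus of continuity `L * ω` and takes values in `[ν, B]`. -/
structure IsCoefficient (ω : ℝ → ℝ) (L ν B : ℝ) (c : ℝ → ℝ) : Prop where
  modulus : ∀ s t, |c s - c t| ≤ L * ω |s - t|
  lower : ∀ t, ν ≤ c t
  upper : ∀ t, c t ≤ B

theorem IsCoefficient.continuous {ω : ℝ → ℝ} (hω : IsContinuityModulus ω) {L ν B : ℝ} {c : ℝ → ℝ}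
    (hc : IsCoefficient ω L ν B c) : Continuous c := by
  rw [continuous_iff_continuousAt]
  intro t
  rw [ContinuousAt, tendsto_iff_dist_tendsto_zero]
  have h1 : Tendsto (fun s => |s - t|) (𝓝 t) (𝓝[Ici 0] 0) := by
    refine tendsto_nhdsWithin_iff.2 ⟨?_, Eventually.of_forall fun s => mem_Ici.2 (abs_nonneg _)⟩
    have : Continuous fun s => |s - t| := by fun_prop
    simpa using this.tendsto t
  have h2 := (hω.continuousOn 0 (by simp)).tendsto.comp h1
  rw [hω.map_zero] at h2
  have h3 := h2.const_mul L
  rw [mul_zero] at h3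
  exact squeeze_zero (fun s => dist_nonneg) (fun s => hc.modulus s t) h3

/-- The averages of a coefficient over intervals of length `ε` are at distance `L ω(ε)` from it, and
their derivatives are bounded by `L ω(ε) / ε`. -/
theorem IsCoefficient.exists_regularization {ω : ℝ → ℝ} (hω : IsContinuityModulus ω) {L ν B : ℝ}
    (hL : 0 ≤ L) {c : ℝ → ℝ} (hc : IsCoefficient ω L ν B c) {ε : ℝ} (hε : 0 < ε) :
    ∃ C C' : ℝ → ℝ, ∀ t, HasDerivAt C (C' t) t ∧ ν ≤ C t ∧ C t ≤ B ∧ |C t - c t| ≤ L * ω ε ∧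
      |C' t| ≤ L * ω ε / ε := by
  have hcont := hc.continuous hω
  have hii : ∀ a b, IntervalIntegrable c volume a b := fun a b => hcont.intervalIntegrable a b
  set I : ℝ → ℝ := fun t => ∫ s in (0 : ℝ)..t, c s with hI
  have hId : ∀ t, HasDerivAt I (c t) t := fun t =>
    intervalIntegral.integral_hasDerivAt_right (hii 0 t)
      (hcont.stronglyMeasurableAtFilter _ _) hcont.continuousAt
  have hdiff : ∀ t, I (t + ε) - I t = ∫ s in t..(t + ε), c s := fun t =>
    intervalIntegral.integral_interval_sub_left (hii _ _) (hii _ _)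
  have hconst : ∀ t k : ℝ, ∫ _ in t..(t + ε), k = k * ε := fun t k => by
    rw [intervalIntegral.integral_const, smul_eq_mul]; ring
  refine ⟨fun t => (I (t + ε) - I t) / ε, fun t => (c (t + ε) - c t) / ε, fun t => ⟨?_, ?_, ?_, ?_, ?_⟩⟩
  · exact (((hId (t + ε)).comp_add_const t ε).sub (hId t)).div_const ε
  · rw [le_div_iff₀ hε, hdiff, ← hconst t ν]
    exact intervalIntegral.integral_mono_on (by linarith) (by simp) (hii _ _) fun s _ => hc.lower s
  · rw [div_le_iff₀ hε, hdiff, ← hconst t B]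
    exact intervalIntegral.integral_mono_on (by linarith) (hii _ _) (by simp) fun s _ => hc.upper s
  · have e : (I (t + ε) - I t) / ε - c t = (∫ s in t..(t + ε), (c s - c t)) / ε := by
      rw [intervalIntegral.integral_sub (hii _ _) (by simp), hconst, hdiff]
      field_simp
    rw [e, abs_div, abs_of_pos hε, div_le_iff₀ hε]
    have := intervalIntegral.norm_integral_le_of_norm_le_const (a := t) (b := t + ε)
      (f := fun s => c s - c t) (C := L * ω ε) (fun s hs => by
        rw [uIoc_of_le (by linarith)] at hs
        refine (hc.modulus s t).trans (mul_le_mul_of_nonneg_left ?_ hL)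
        refine hω.monotoneOn (mem_Ici.2 (abs_nonneg _)) (mem_Ici.2 hε.le) ?_
        rw [abs_of_nonneg (by linarith [hs.1])]
        linarith [hs.2])
    rwa [Real.norm_eq_abs, add_sub_cancel_left, abs_of_pos hε] at this
  · rw [abs_div, abs_of_pos hε]
    refine div_le_div_of_nonneg_right ?_ hε.le
    have := hc.modulus (t + ε) t
    rwa [add_sub_cancel_left, abs_of_pos hε] at this

/-! ### Frequency blocks -/

/-- A decomposition of the frequencies `l ≥ 0` into the blocks `{κ = k}`, adapted to the weight `φ`
and to the modulus of continuity `ω`: frequencies in the block `k` do not exceed `b k`, the weight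
is at least `w k` there, and every coefficient with modulus of continuity `L * ω` and values in
`[ν, B]` has a differentiable substitute in each block whose approximation error and logarithmic
derivative, measured at the frequencies of the block, are controlled by `w k`. -/
structure FrequencyBlocks (ω φ : ℝ → ℝ) (ν : ℝ) (κ : ℝ → ℕ) (b w : ℕ → ℝ) : Prop where
  measurable : Measurable κ
  b_nonneg : ∀ k, 0 ≤ b k
  le_b : ∀ l, 0 ≤ l → l ≤ b (κ l)
  w_le : ∀ l, 0 ≤ l → w (κ l) ≤ φ l
  one_le : ∀ k, 1 ≤ w k
  low : ∃ b₀ > 0, ∀ l, 0 ≤ l → l ≤ b₀ → w (κ l) = 1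
  substitute : ∀ (L B : ℝ) (c : ℝ → ℝ), 0 ≤ L → IsCoefficient ω L ν B c → ∃ K, 0 < K ∧ ∀ k,
    ∃ C C' : ℝ → ℝ, ∀ t, HasDerivAt C (C' t) t ∧ 0 < C t ∧ C t ≤ K ∧ 1 ≤ K * w k * C t ∧
      |C t - c t| * b k ≤ K * w k * √(C t) ∧ |C' t| ≤ K * w k * C t

/-- The blocks with end points `e 0, e 1, …`; frequencies below `e 0` form the block `0`. -/
theorem exists_block_index {e : ℕ → ℝ} (he : ∀ l, ∃ k, l ≤ e k) :
    ∃ κ : ℝ → ℕ, Measurable κ ∧ (∀ l, l ≤ e (κ l)) ∧ (∀ l, l ≤ e 0 → κ l = 0) ∧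
      ∀ l k, κ l = k + 1 → e k < l := by
  classical
  refine ⟨fun l => Nat.find (he l), ?_, fun l => Nat.find_spec (he l), fun l hl => ?_,
    fun l k hk => ?_⟩
  · have : Monotone fun l => Nat.find (he l) := fun l l' hll =>
      Nat.find_mono fun n hn => hll.trans hn
    exact this.measurable
  · exact (Nat.find_eq_zero _).2 hl
  · have := Nat.find_min (he l) (m := k) (lt_of_lt_of_eq (Nat.lt_succ_self k) hk.symm)
    exact not_le.1 this

/-- Blocks in the strictly hyperbolic case `ν > 0`: dyadic intervals `(2 ^ k, 2 ^ (k + 1)]`, in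
which a coefficient is averaged over intervals of length `2⁻ᵏ⁻¹`, the inverse of the frequency. -/
theorem exists_frequencyBlocks_of_pos {ω φ : ℝ → ℝ} (hω : IsContinuityModulus ω) {ν Λ : ℝ}
    (hν : 0 < ν) (hφ : ∀ σ, 0 ≤ σ → 1 ≤ φ σ) (hΛ : ∀ σ, 0 < σ → σ * ω (1 / σ) ≤ Λ * φ σ) :
    ∃ κ b w, FrequencyBlocks ω φ ν κ b w := by
  -- `Λ` need not be positive if `ω = 0`
  set Λ' := |Λ| + 1 with hΛ'
  have hΛ'0 : 0 < Λ' := by positivity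
  have hΛ2 : ∀ σ, 0 < σ → σ * ω (1 / σ) ≤ Λ' * φ σ := fun σ hσ => (hΛ σ hσ).trans
    (mul_le_mul_of_nonneg_right ((le_abs_self Λ).trans (by linarith))
      (zero_le_one.trans (hφ σ hσ.le)))
  obtain ⟨κ, hκ, h1, h2, h3⟩ := exists_block_index (e := fun k => (2 : ℝ) ^ k) fun l => by
    obtain ⟨k, hk⟩ := pow_unbounded_of_one_lt l (one_lt_two (α := ℝ))
    exact ⟨k, hk.le⟩
  set w : ℕ → ℝ := fun k => Nat.rec 1 (fun k _ => max 1 (2 ^ k * ω (1 / 2 ^ (k + 1)) / Λ')) k with hw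
  have hw1 : ∀ k, 1 ≤ w k := fun k => by
    cases k with
    | zero => exact le_rfl
    | succ k => exact le_max_left _ _
  refine ⟨κ, fun k => 2 ^ k, w, hκ, fun k => by positivity, fun l _ => h1 l, fun l hl => ?_, hw1,
    ⟨1, one_pos, fun l _ hl => ?_⟩, fun L B c hL hc => ?_⟩
  · rcases hk : κ l with _ | k
    · exact hφ l hl
    · have h4 := h3 l k hk
      have h5 := h1 l
      rw [hk] at h5
      have hp : (0 : ℝ) < 2 ^ k := by positivity
      have hl0 : 0 < l := hp.trans h4
      refine max_le (hφ l hl) ?_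
      rw [div_le_iff₀ hΛ'0, mul_comm (φ l)]
      refine le_trans ?_ (hΛ2 l hl0)
      refine mul_le_mul h4.le ?_ (hω.nonneg _ (by positivity)) hl0.le
      exact hω.monotoneOn (mem_Ici.2 (by positivity)) (mem_Ici.2 (by positivity))
        (one_div_le_one_div_of_le hl0 h5)
  · rw [h2 l (by simpa using hl)]; rfl
  · have hB : 0 < B := hν.trans_le ((hc.lower 0).trans (hc.upper 0))
    set K := 1 + B + 1 / ν + 2 * L * Λ' / √ν + 2 * L * Λ' / ν with hK
    have a1 : 0 ≤ 1 / ν := by positivity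
    have a2 : 0 ≤ 2 * L * Λ' / √ν := by positivity
    have a3 : 0 ≤ 2 * L * Λ' / ν := by positivity
    refine ⟨K, by positivity, fun k => ?_⟩
    rcases k with _ | k
    -- in the block of low frequencies, the constant coefficient `1` is good enough
    · refine ⟨fun _ => 1, fun _ => 0, fun t => ⟨hasDerivAt_const _ _, one_pos, by linarith, ?_, ?_, ?_⟩⟩
      · change 1 ≤ K * 1 * 1
        linarith
      · change |1 - c t| * 2 ^ 0 ≤ K * 1 * √1
        rw [Real.sqrt_one, pow_zero, mul_one, mul_one, mul_one, abs_le]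
        have := hc.lower t
        have := hc.upper t
        constructor <;> linarith
      · change |(0 : ℝ)| ≤ K * 1 * 1
        rw [abs_zero]
        positivity
    · obtain ⟨C, C', hC⟩ := hc.exists_regularization hω hL (ε := 1 / 2 ^ (k + 1)) (by positivity)
      refine ⟨C, C', fun t => ?_⟩
      obtain ⟨c1, c2, c3, c4, c5⟩ := hC t
      have hwk := hw1 (k + 1)
      have hw0 : 0 < w (k + 1) := by linarith
      -- the block reaches down to `2 ^ k`, where `φ` is bounded below by `2 ^ k * ω(2⁻ᵏ⁻¹) / Λ'`
      have hloss : ω (1 / 2 ^ (k + 1)) * 2 ^ (k + 1) ≤ 2 * Λ' * w (k + 1) := by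
        have : 2 ^ k * ω (1 / 2 ^ (k + 1)) / Λ' ≤ w (k + 1) := le_max_right _ _
        rw [div_le_iff₀ hΛ'0] at this
        rw [pow_succ]
        rw [pow_succ] at this
        linarith
      have hloss' : L * ω (1 / 2 ^ (k + 1)) * 2 ^ (k + 1) ≤ 2 * L * Λ' * w (k + 1) := by
        have := mul_le_mul_of_nonneg_left hloss hL
        linarith
      refine ⟨c1, hν.trans_le c2, by linarith, ?_, ?_, ?_⟩
      · have e1 : 1 = 1 / ν * 1 * ν := by field_simp
        rw [e1]
        gcongr
        linarith
      · have e2 : |C t - c t| * 2 ^ (k + 1) ≤ 2 * L * Λ' * w (k + 1) :=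
          (mul_le_mul_of_nonneg_right c4 (by positivity)).trans hloss'
        refine e2.trans ?_
        have e3 : 2 * L * Λ' * w (k + 1) = (2 * L * Λ' / √ν) * w (k + 1) * √ν := by
          have : √ν ≠ 0 := (Real.sqrt_pos.2 hν).ne'
          field_simp
        rw [e3]
        gcongr
        linarith
      · have e2 : |C' t| ≤ 2 * L * Λ' * w (k + 1) := by
          refine c5.trans ?_
          rw [one_div, div_inv_eq_mul, ← one_div]
          exact hloss'
        refine e2.trans ?_
        have e3 : 2 * L * Λ' * w (k + 1) = (2 * L * Λ' / ν) * w (k + 1) * ν := by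
          field_simp
        rw [e3]
        gcongr
        linarith

/-- Blocks in the weakly hyperbolic case: with `g σ = σ / √ω(1 / σ)`, the blocks are the intervals
`(g (2 ^ k), g (2 ^ (k + 1))]`. The substitute for a coefficient is its average over intervals of
length `ε = 2⁻ᵏ⁻¹` plus `ω ε`, which keeps it away from `0`; both error terms are then of order
`1 / ε`. -/
theorem exists_frequencyBlocks_of_zero {ω φ : ℝ → ℝ} (hω : IsContinuityModulus ω) {Λ : ℝ}
    (hφ : ∀ σ, 0 ≤ σ → 1 ≤ φ σ) (hΛ : ∀ σ, 0 < σ → σ ≤ Λ * φ (σ / √(ω (1 / σ)))) :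
    ∃ κ b w, FrequencyBlocks ω φ 0 κ b w := by
  have hφ0 : ∀ σ, 0 < σ → 0 < φ (σ / √(ω (1 / σ))) := fun σ hσ =>
    zero_lt_one.trans_le (hφ _ (by positivity))
  have hΛ0 : 0 < Λ := by
    by_contra h
    have := mul_nonpos_of_nonpos_of_nonneg (not_lt.1 h) (hφ0 1 one_pos).le
    have := hΛ 1 one_pos
    linarith
  -- `ω` is positive: otherwise it vanishes near `0`, and the left-hand side of `hΛ` is unbounded
  -- while its right-hand side stays equal to `Λ * φ 0`
  have hωpos : ∀ x, 0 < x → 0 < ω x := by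
    intro x hx
    refine lt_of_le_of_ne (hω.nonneg x hx.le) fun h => ?_
    set σ := max (1 / x) (Λ * φ 0 + 1) with hσ
    have hσ0 : 0 < σ := (one_div_pos.2 hx).trans_le (le_max_left _ _)
    have h1 : ω (1 / σ) = 0 := by
      refine le_antisymm ?_ (hω.nonneg _ (by positivity))
      rw [h]
      refine hω.monotoneOn (mem_Ici.2 (by positivity)) (mem_Ici.2 hx.le) ?_
      rw [one_div_le hσ0 hx]
      exact le_max_left _ _
    have h2 := hΛ σ hσ0
    rw [h1, Real.sqrt_zero, div_zero] at h2
    have := le_max_right (1 / x) (Λ * φ 0 + 1)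
    linarith
  set g : ℝ → ℝ := fun σ => σ / √(ω (1 / σ)) with hg
  have hgc : ContinuousOn g (Ioi 0) := by
    refine continuousOn_id.div ?_ fun σ hσ => (Real.sqrt_pos.2 (hωpos _ (one_div_pos.2 hσ))).ne'
    refine Real.continuous_sqrt.comp_continuousOn (hω.continuousOn.comp ?_ ?_)
    · exact continuousOn_const.div continuousOn_id fun σ hσ => (ne_of_gt hσ)
    · exact fun σ hσ => mem_Ici.2 (one_div_nonneg.2 (le_of_lt hσ))
  have hω1 := hωpos 1 one_pos
  have hωk : ∀ k : ℕ, ω (1 / 2 ^ k) ≤ ω 1 := fun k =>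
    hω.monotoneOn (mem_Ici.2 (by positivity)) (mem_Ici.2 zero_le_one)
      (by rw [div_le_one (by positivity)]; exact one_le_pow₀ one_le_two)
  obtain ⟨κ, hκ, h1, h2, h3⟩ := exists_block_index (e := fun k => g (2 ^ k)) fun l => by
    obtain ⟨k, hk⟩ := pow_unbounded_of_one_lt (l * √(ω 1)) (one_lt_two (α := ℝ))
    refine ⟨k, ?_⟩
    have hs : 0 < √(ω 1) := Real.sqrt_pos.2 hω1
    have h4 : l ≤ 2 ^ k / √(ω 1) := (le_div_iff₀ hs).2 hk.le
    refine h4.trans (div_le_div_of_nonneg_left (by positivity) ?_ (Real.sqrt_le_sqrt (hωk k)))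
    exact Real.sqrt_pos.2 (hωpos _ (by positivity))
  set w : ℕ → ℝ := fun k => Nat.rec 1 (fun k _ => max 1 (2 ^ k / Λ)) k with hw
  have hw1 : ∀ k, 1 ≤ w k := fun k => by
    cases k with
    | zero => exact le_rfl
    | succ k => exact le_max_left _ _
  refine ⟨κ, fun k => g (2 ^ k), w, hκ, fun k => div_nonneg (by positivity) (Real.sqrt_nonneg _),
    fun l _ => h1 l, fun l hl => ?_, hw1,
    ⟨g 1, div_pos one_pos (Real.sqrt_pos.2 (hωpos _ (by norm_num))), fun l _ hl => ?_⟩,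
    fun L B c hL hc => ?_⟩
  · rcases hk : κ l with _ | k
    · exact hφ l hl
    · have h4 := h3 l k hk
      have h5 := h1 l
      rw [hk] at h5
      have hp : (0 : ℝ) < 2 ^ k := by positivity
      obtain ⟨σ, hσ, e⟩ := intermediate_value_Icc (a := (2 : ℝ) ^ k) (b := 2 ^ (k + 1))
        (pow_le_pow_right₀ one_le_two (Nat.le_succ k))
        (hgc.mono fun x hx => mem_Ioi.2 (hp.trans_le hx.1)) ⟨h4.le, h5⟩
      refine max_le (hφ l hl) ?_
      rw [div_le_iff₀ hΛ0, mul_comm (φ l)]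
      have := hΛ σ (hp.trans_le hσ.1)
      rw [show σ / √(ω (1 / σ)) = l from e] at this
      exact hσ.1.trans this
  · rw [h2 l (by simpa using hl)]; rfl
  · have hB : 0 ≤ B := (hc.lower 0).trans (hc.upper 0)
    have hg1 : 0 < g 1 := div_pos one_pos (Real.sqrt_pos.2 (hωpos _ (by norm_num)))
    set K := 1 + B + ω 1 + (1 + B) * g 1 + 2 * Λ / ω 1 + (L + 1) * (2 * Λ) with hK
    have a1 : 0 ≤ 2 * Λ / ω 1 := by positivity
    have a2 : 0 ≤ (1 + B) * g 1 := by positivity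
    have a3 : 0 ≤ (L + 1) * (2 * Λ) := by positivity
    refine ⟨K, by positivity, fun k => ?_⟩
    rcases k with _ | k
    -- in the block of low frequencies, the constant coefficient `1` is good enough
    · refine ⟨fun _ => 1, fun _ => 0, fun t => ⟨hasDerivAt_const _ _, one_pos, by linarith, ?_, ?_, ?_⟩⟩
      · change 1 ≤ K * 1 * 1
        linarith
      · change |1 - c t| * g (2 ^ 0) ≤ K * 1 * √1
        rw [Real.sqrt_one, pow_zero, mul_one, mul_one]
        have e1 : |1 - c t| ≤ 1 + B := by
          rw [abs_le]
          have := hc.lower t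
          have := hc.upper t
          constructor <;> linarith
        have := mul_le_mul_of_nonneg_right e1 hg1.le
        linarith
      · change |(0 : ℝ)| ≤ K * 1 * 1
        rw [abs_zero]
        positivity
    · have hσ : (0 : ℝ) < 2 ^ (k + 1) := by positivity
      obtain ⟨C, C', hC⟩ := hc.exists_regularization hω hL (ε := 1 / 2 ^ (k + 1)) (by positivity)
      set θ := ω (1 / 2 ^ (k + 1)) with hθ
      have hθ0 : 0 < θ := hωpos _ (by positivity)
      refine ⟨fun t => C t + θ, C', fun t => ?_⟩
      obtain ⟨c1, c2, c3, c4, c5⟩ := hC t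
      have hw0 : 0 < w (k + 1) := by linarith [hw1 (k + 1)]
      have hloss : 2 ^ (k + 1) ≤ 2 * Λ * w (k + 1) := by
        have : 2 ^ k / Λ ≤ w (k + 1) := le_max_right _ _
        rw [div_le_iff₀ hΛ0] at this
        rw [pow_succ]
        linarith
      have hθC : θ ≤ C t + θ := by linarith
      refine ⟨c1.add_const θ, by linarith, by linarith [hωk (k + 1)], ?_, ?_, ?_⟩
      -- subadditivity bounds `ω` from below, so that `1 / ω ε` is of order `1 / ε` at most
      · have e1 : ω 1 ≤ 2 ^ (k + 1) * θ := by
          have := hω.nat_mul_le (a := 1 / 2 ^ (k + 1)) (by positivity) (2 ^ (k + 1))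
          push_cast at this
          rwa [mul_one_div_cancel hσ.ne'] at this
        have e2 : ω 1 ≤ 2 * Λ * w (k + 1) * (C t + θ) :=
          e1.trans (mul_le_mul hloss hθC hθ0.le (by positivity))
        have e3 : 1 ≤ 2 * Λ / ω 1 * w (k + 1) * (C t + θ) := by
          rw [div_mul_eq_mul_div, div_mul_eq_mul_div, le_div_iff₀ hω1, one_mul]
          exact e2
        refine e3.trans ?_
        gcongr
        linarith
      · have e1 : |C t + θ - c t| ≤ (L + 1) * θ := by
          rw [abs_le] at c4 ⊢
          constructor <;> linarith [c4.1, c4.2]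
        have hs : 0 < √θ := Real.sqrt_pos.2 hθ0
        have e2 : θ * g (2 ^ (k + 1)) = √θ * 2 ^ (k + 1) := by
          change θ * (2 ^ (k + 1) / √θ) = _
          rw [mul_div_assoc', div_eq_iff hs.ne']
          linear_combination (-(2 : ℝ) ^ (k + 1)) * Real.mul_self_sqrt hθ0.le
        calc |C t + θ - c t| * g (2 ^ (k + 1)) ≤ (L + 1) * θ * g (2 ^ (k + 1)) :=
              mul_le_mul_of_nonneg_right e1 (div_nonneg hσ.le (Real.sqrt_nonneg _))
          _ = (L + 1) * 2 ^ (k + 1) * √θ := by rw [mul_assoc, e2]; ring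
          _ ≤ (L + 1) * (2 * Λ * w (k + 1)) * √(C t + θ) := by gcongr
          _ = (L + 1) * (2 * Λ) * w (k + 1) * √(C t + θ) := by ring
          _ ≤ K * w (k + 1) * √(C t + θ) := by
            gcongr
            linarith
      · calc |C' t| ≤ L * θ / (1 / 2 ^ (k + 1)) := c5
          _ = L * 2 ^ (k + 1) * θ := by field_simp
          _ ≤ (L + 1) * (2 * Λ * w (k + 1)) * (C t + θ) := by
            gcongr
            linarith
          _ = (L + 1) * (2 * Λ) * w (k + 1) * (C t + θ) := by ring
          _ ≤ K * w (k + 1) * (C t + θ) := by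
            have : 0 ≤ C t + θ := by linarith
            gcongr
            linarith


/-! ### Energy estimates in a frequency block -/

section BlockEnergy

variable {E : Type*} [NormedAddCommGroup E] [InnerProductSpace ℝ E]

/-- The energy `‖Z‖² + C ‖X‖²` of the system `X' = B Z + f`, `Z' = -c B X + g`, where `C` is a
regularization of the coefficient `c`, with an exponential weight whose decrease in time absorbs the
errors `|C - c|` and `|C'|`. -/
theorem exists_hasDerivAt_blockEnergy (B : E →L[ℝ] E) (hB : ∀ x y, inner ℝ (B x) y = inner ℝ x (B y))
    {b K w r t c C' : ℝ} {X Z : ℝ → E} {C : ℝ → ℝ} {f g : E}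
    (hb : ∀ x, ‖B x‖ ≤ b * ‖x‖) (hw : 1 ≤ w) (ht : 0 ≤ t) (hK : 0 < K)
    (hX : HasDerivAt X (B (Z t) + f) t) (hZ : HasDerivAt Z (-c • B (X t) + g) t)
    (hC : HasDerivAt C C' t) (hC0 : 0 < C t) (hCK : C t ≤ K)
    (hCc : |C t - c| * b ≤ K * w * √(C t)) (hC' : |C'| ≤ K * w * C t) :
    ∃ D, HasDerivAt (fun s => Real.exp ((r - (2 * K + 1) * s) * w) *
        (‖Z s‖ ^ 2 + C s * ‖X s‖ ^ 2)) D t ∧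
      D ≤ Real.exp (r * w) * (‖g‖ ^ 2 + K * ‖f‖ ^ 2) := by
  set e := Real.exp ((r - (2 * K + 1) * t) * w) with he
  have hexp : HasDerivAt (fun s => Real.exp ((r - (2 * K + 1) * s) * w)) (e * (-(2 * K + 1) * w)) t := by
    have h1 : HasDerivAt (fun s : ℝ => (r - (2 * K + 1) * s) * w) (-(2 * K + 1) * w) t := by
      have := (((hasDerivAt_id t).const_mul (2 * K + 1)).const_sub r).mul_const w
      simpa using this
    exact h1.exp
  have hE : HasDerivAt (fun s => ‖Z s‖ ^ 2 + C s * ‖X s‖ ^ 2)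
      (2 * inner ℝ (Z t) (-c • B (X t) + g) +
        (C' * ‖X t‖ ^ 2 + C t * (2 * inner ℝ (X t) (B (Z t) + f)))) t :=
    hZ.norm_sq.add (hC.mul hX.norm_sq)
  refine ⟨_, hexp.mul hE, ?_⟩
  set x := ‖X t‖ with hx
  set z := ‖Z t‖ with hz
  set S := √(C t) with hS
  have hS2 : S ^ 2 = C t := Real.sq_sqrt hC0.le
  have e1 : inner ℝ (X t) (B (Z t)) = inner ℝ (Z t) (B (X t)) := by
    rw [← hB, real_inner_comm]
  have e2 : 2 * inner ℝ (Z t) (-c • B (X t) + g) +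
        (C' * x ^ 2 + C t * (2 * inner ℝ (X t) (B (Z t) + f))) =
      2 * ((C t - c) * inner ℝ (Z t) (B (X t))) + C' * x ^ 2 + 2 * inner ℝ (Z t) g +
        2 * (C t * inner ℝ (X t) f) := by
    rw [inner_add_right, inner_add_right, inner_smul_right, e1]
    ring
  have b1 : (C t - c) * inner ℝ (Z t) (B (X t)) ≤ K * w * (S * x * z) := by
    calc (C t - c) * inner ℝ (Z t) (B (X t)) ≤ |C t - c| * |inner ℝ (Z t) (B (X t))| := by
          rw [← abs_mul]; exact le_abs_self _
      _ ≤ |C t - c| * (z * (b * x)) := by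
          gcongr
          exact (abs_real_inner_le_norm _ _).trans
            (mul_le_mul_of_nonneg_left (hb _) (norm_nonneg _))
      _ = |C t - c| * b * (z * x) := by ring
      _ ≤ K * w * S * (z * x) := by gcongr
      _ = K * w * (S * x * z) := by ring
  have b2 : C' * x ^ 2 ≤ K * w * C t * x ^ 2 :=
    mul_le_mul_of_nonneg_right ((le_abs_self _).trans hC') (sq_nonneg _)
  have b3 : 2 * inner ℝ (Z t) g ≤ z ^ 2 + ‖g‖ ^ 2 := by
    have := real_inner_le_norm (Z t) g
    nlinarith [sq_nonneg (z - ‖g‖)]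
  have b4 : 2 * (C t * inner ℝ (X t) f) ≤ C t * x ^ 2 + K * ‖f‖ ^ 2 := by
    have h1 := real_inner_le_norm (X t) f
    have h2 : 2 * inner ℝ (X t) f ≤ x ^ 2 + ‖f‖ ^ 2 := by nlinarith [sq_nonneg (x - ‖f‖)]
    have h3 := mul_le_mul_of_nonneg_left h2 hC0.le
    have h4 := mul_le_mul_of_nonneg_right hCK (sq_nonneg ‖f‖)
    linarith
  have b5 : 2 * (S * x * z) ≤ z ^ 2 + C t * x ^ 2 := by
    rw [← hS2]
    nlinarith [sq_nonneg (S * x - z)]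
  have b6 : K * w * (2 * (S * x * z)) ≤ K * w * (z ^ 2 + C t * x ^ 2) :=
    mul_le_mul_of_nonneg_left b5 (by positivity)
  have b7 : z ^ 2 + C t * x ^ 2 ≤ w * (z ^ 2 + C t * x ^ 2) := by
    have : 0 ≤ z ^ 2 + C t * x ^ 2 := by positivity
    nlinarith
  have b8 : 0 ≤ K * w * z ^ 2 := by positivity
  have tot : -(2 * K + 1) * w * (z ^ 2 + C t * x ^ 2) +
      (2 * inner ℝ (Z t) (-c • B (X t) + g) +
        (C' * x ^ 2 + C t * (2 * inner ℝ (X t) (B (Z t) + f)))) ≤ ‖g‖ ^ 2 + K * ‖f‖ ^ 2 := by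
    rw [e2]
    linarith
  have hle : e ≤ Real.exp (r * w) := by
    rw [he, Real.exp_le_exp]
    have : 0 ≤ (2 * K + 1) * t * w := by positivity
    linarith
  calc e * (-(2 * K + 1) * w) * (z ^ 2 + C t * x ^ 2) + e * (2 * inner ℝ (Z t) (-c • B (X t) + g) +
        (C' * x ^ 2 + C t * (2 * inner ℝ (X t) (B (Z t) + f))))
      = e * (-(2 * K + 1) * w * (z ^ 2 + C t * x ^ 2) +
      (2 * inner ℝ (Z t) (-c • B (X t) + g) +
        (C' * x ^ 2 + C t * (2 * inner ℝ (X t) (B (Z t) + f))))) := by ring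
    _ ≤ e * (‖g‖ ^ 2 + K * ‖f‖ ^ 2) := mul_le_mul_of_nonneg_left tot (Real.exp_pos _).le
    _ ≤ Real.exp (r * w) * (‖g‖ ^ 2 + K * ‖f‖ ^ 2) :=
        mul_le_mul_of_nonneg_right hle (by positivity)

end BlockEnergy


/-! ### Solutions in the spectral representation -/

/-- Product rule for `⟪F, G⟫` at a zero of `G`: continuity of `F` suffices. -/
theorem HasDerivWithinAt.inner_of_eq_zero {E : Type*} [NormedAddCommGroup E] [InnerProductSpace ℝ E]
    {F G : ℝ → E} {G' : E} {s : Set ℝ} {t : ℝ} (hF : ContinuousWithinAt F s t)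
    (hG : HasDerivWithinAt G G' s t) (h0 : G t = 0) :
    HasDerivWithinAt (fun r => inner ℝ (F r) (G r)) (inner ℝ (F t) G') s t := by
  rw [hasDerivWithinAt_iff_tendsto_slope] at hG ⊢
  have hF' : Tendsto F (𝓝[s \ {t}] t) (𝓝 (F t)) := hF.mono_left (nhdsWithin_mono _ sdiff_subset)
  refine (hF'.inner hG).congr fun r => ?_
  simp only [slope, vsub_eq_sub, h0, sub_zero, inner_zero_right, inner_smul_right, smul_eq_mul]

theorem IsOmegaContinuous.continuousOn {ω m : ℝ → ℝ} (hω : IsContinuityModulus ω)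
    (hm : IsOmegaContinuous ω m) : ContinuousOn m (Ici 0) := by
  obtain ⟨L, hL⟩ := hm
  intro s hs
  rw [ContinuousWithinAt, tendsto_iff_dist_tendsto_zero]
  have h1 : Tendsto (fun s' => |s' - s|) (𝓝[Ici 0] s) (𝓝[Ici 0] 0) := by
    refine tendsto_nhdsWithin_iff.2 ⟨?_, Eventually.of_forall fun s => mem_Ici.2 (abs_nonneg _)⟩
    have : Continuous fun s' => |s' - s| := by fun_prop
    simpa using (this.tendsto s).mono_left nhdsWithin_le_nhds
  have h2 := ((hω.continuousOn 0 (by simp)).tendsto.comp h1).const_mul L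
  rw [hω.map_zero, mul_zero] at h2
  refine squeeze_zero' (Eventually.of_forall fun _ => dist_nonneg) ?_ h2
  filter_upwards [self_mem_nhdsWithin] with s' hs'
  exact hL s' s hs' hs

section SpectralSolution

variable {M : Type*} [MeasurableSpace M] {μ : Measure M}

/-- `(x, p)` is a solution on `[0, a]` of the Kirchhoff equation `x' = p`,
`p' = -m(‖lam x‖²) lam² x` in `L²(μ)`, where the operator is the multiplication by `lam²`, and the
norms of `(x, p)` in the Gevrey spaces of order `3/2` and `1` with weight `exp (r * Φ)` are bounded
by `Q`. The bounds are listed in the form in which they are used; the low frequencies make each of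
them a consequence of bounds for `‖x‖`, `‖p‖` and the seminorms. -/
structure SpectralSolution (μ : Measure M) (lam Φ : M → ℝ) (m : ℝ → ℝ) (r a Q : ℝ)
    (x p : ℝ → Lp ℝ 2 μ) : Prop where
  deriv_x : ∀ t ∈ Icc 0 a, HasDerivWithinAt x (p t) (Icc 0 a) t
  deriv_p : ∀ t ∈ Icc 0 a, HasDerivWithinAt p
    (-(m (‖mulL2 lam (x t)‖ ^ 2)) • mulL2 (fun ξ => lam ξ ^ 2) (x t)) (Icc 0 a) t
  continuousOn : ContinuousOn (fun t => mulL2 (fun ξ => lam ξ ^ 2) (x t)) (Icc 0 a)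
  dom_x₁ : ∀ t ∈ Icc 0 a, MulDom lam (x t)
  dom_x₂ : ∀ t ∈ Icc 0 a, MulDom (fun ξ => lam ξ ^ 2) (x t)
  dom_x₃ : ∀ t ∈ Icc 0 a, MulDom (fun ξ => lam ξ ^ 3) (x t)
  dom_p₁ : ∀ t ∈ Icc 0 a, MulDom lam (p t)
  dom_p₂ : ∀ t ∈ Icc 0 a, MulDom (fun ξ => lam ξ ^ 2) (p t)
  dom_exp_x : ∀ t ∈ Icc 0 a, MulDom (fun ξ => lam ξ ^ 2 * Real.exp (r * Φ ξ / 2)) (x t)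
  dom_exp_p : ∀ t ∈ Icc 0 a, MulDom (fun ξ => lam ξ * Real.exp (r * Φ ξ / 2)) (p t)
  norm_x₃ : ∀ t ∈ Icc 0 a, ‖mulL2 (fun ξ => lam ξ ^ 3) (x t)‖ ≤ Q
  norm_p₂ : ∀ t ∈ Icc 0 a, ‖mulL2 (fun ξ => lam ξ ^ 2) (p t)‖ ≤ Q
  norm_exp_x : ∀ t ∈ Icc 0 a, ‖mulL2 (fun ξ => lam ξ ^ 2 * Real.exp (r * Φ ξ / 2)) (x t)‖ ≤ Q
  norm_exp_p : ∀ t ∈ Icc 0 a, ‖mulL2 (fun ξ => lam ξ * Real.exp (r * Φ ξ / 2)) (p t)‖ ≤ Q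

/-- The first derivative of `‖lam x‖²` along a solution. -/
noncomputable def firstDeriv (lam : M → ℝ) (x p : Lp ℝ 2 μ) : ℝ :=
  2 * inner ℝ (mulL2 (fun ξ => lam ξ ^ 2) x) p

/-- The second derivative of `‖lam x‖²` along a solution. -/
noncomputable def secondDeriv (lam : M → ℝ) (m : ℝ → ℝ) (x p : Lp ℝ 2 μ) : ℝ :=
  2 * (‖mulL2 lam p‖ ^ 2 - m (‖mulL2 lam x‖ ^ 2) * ‖mulL2 (fun ξ => lam ξ ^ 2) x‖ ^ 2)

theorem inner_mulL2_sq_symm {lam : M → ℝ} {x y : Lp ℝ 2 μ} (hx : MulDom (fun ξ => lam ξ ^ 2) x)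
    (hy : MulDom (fun ξ => lam ξ ^ 2) y) :
    inner ℝ (mulL2 (fun ξ => lam ξ ^ 2) x) y = inner ℝ (mulL2 (fun ξ => lam ξ ^ 2) y) x := by
  have h := inner_mulL2_eq hx (mulL2_one y).1 (mulL2_one x).1 hy (fun ξ => by ring)
  rw [(mulL2_one x).2, (mulL2_one y).2] at h
  rw [h, real_inner_comm]

theorem norm_mulL2_sq_eq_inner {lam : M → ℝ} {x : Lp ℝ 2 μ} (h₁ : MulDom lam x)
    (h₂ : MulDom (fun ξ => lam ξ ^ 2) x) :
    ‖mulL2 lam x‖ ^ 2 = inner ℝ (mulL2 (fun ξ => lam ξ ^ 2) x) x := by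
  have h := inner_mulL2_eq h₁ h₁ h₂ (mulL2_one x).1 (fun ξ => by ring)
  rw [(mulL2_one x).2] at h
  rw [← h, real_inner_self_eq_norm_sq]

theorem norm_mulL2_sq_sub {lam : M → ℝ} {x y : Lp ℝ 2 μ} (h₁ : MulDom lam x)
    (h₂ : MulDom (fun ξ => lam ξ ^ 2) x) (h₃ : MulDom lam y)
    (h₄ : MulDom (fun ξ => lam ξ ^ 2) y) :
    ‖mulL2 lam x‖ ^ 2 - ‖mulL2 lam y‖ ^ 2 =
      inner ℝ (mulL2 (fun ξ => lam ξ ^ 2) x + mulL2 (fun ξ => lam ξ ^ 2) y) (x - y) := by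
  rw [norm_mulL2_sq_eq_inner h₁ h₂, norm_mulL2_sq_eq_inner h₃ h₄, inner_add_left, inner_sub_right,
    inner_sub_right, inner_mulL2_sq_symm h₂ h₄]
  ring

theorem norm_mulL2_pow_two_sq_sub {lam : M → ℝ} {x y : Lp ℝ 2 μ} (hx₁ : MulDom lam x)
    (hx₂ : MulDom (fun ξ => lam ξ ^ 2) x) (hx₃ : MulDom (fun ξ => lam ξ ^ 3) x)
    (hy₁ : MulDom lam y) (hy₂ : MulDom (fun ξ => lam ξ ^ 2) y)
    (hy₃ : MulDom (fun ξ => lam ξ ^ 3) y) :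
    ‖mulL2 (fun ξ => lam ξ ^ 2) x‖ ^ 2 - ‖mulL2 (fun ξ => lam ξ ^ 2) y‖ ^ 2 =
      inner ℝ (mulL2 (fun ξ => lam ξ ^ 3) x + mulL2 (fun ξ => lam ξ ^ 3) y)
        (mulL2 lam (x - y)) := by
  have e1 := inner_mulL2_eq hx₂ hx₂ hx₃ hx₁ (fun ξ => by ring)
  have e2 := inner_mulL2_eq hy₂ hy₂ hy₃ hy₁ (fun ξ => by ring)
  have e3 := (inner_mulL2_eq hx₃ hy₁ hx₁ hy₃ (fun ξ => by ring)).trans (real_inner_comm _ _)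
  rw [← real_inner_self_eq_norm_sq, ← real_inner_self_eq_norm_sq, e1, e2, (mulL2_sub hx₁ hy₁).2,
    inner_add_left, inner_sub_right, inner_sub_right, e3]
  ring

/-- For two states with the same value of `‖lam x‖²`, the second derivatives of this quantity differ
by no more than a multiple of the energy norm of the difference of the states. No continuity of `m`
is involved. -/
theorem abs_secondDeriv_sub_le {lam : M → ℝ} {m : ℝ → ℝ} {x p y q : Lp ℝ 2 μ} {Q B : ℝ}
    (hx₁ : MulDom lam x) (hx₂ : MulDom (fun ξ => lam ξ ^ 2) x)
    (hx₃ : MulDom (fun ξ => lam ξ ^ 3) x) (hp₁ : MulDom lam p)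
    (hp₂ : MulDom (fun ξ => lam ξ ^ 2) p)
    (hy₁ : MulDom lam y) (hy₂ : MulDom (fun ξ => lam ξ ^ 2) y)
    (hy₃ : MulDom (fun ξ => lam ξ ^ 3) y) (hq₁ : MulDom lam q)
    (hq₂ : MulDom (fun ξ => lam ξ ^ 2) q)
    (bound_x : ‖mulL2 (fun ξ => lam ξ ^ 3) x‖ ≤ Q) (bound_y : ‖mulL2 (fun ξ => lam ξ ^ 3) y‖ ≤ Q)
    (bound_p : ‖mulL2 (fun ξ => lam ξ ^ 2) p‖ ≤ Q) (bound_q : ‖mulL2 (fun ξ => lam ξ ^ 2) q‖ ≤ Q)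
    (hxy : ‖mulL2 lam y‖ ^ 2 = ‖mulL2 lam x‖ ^ 2) (hB : |m (‖mulL2 lam x‖ ^ 2)| ≤ B) :
    |secondDeriv lam m x p - secondDeriv lam m y q| ≤
      4 * Q * (1 + B) * √(‖p - q‖ ^ 2 + ‖mulL2 lam (x - y)‖ ^ 2) := by
  set N := √(‖p - q‖ ^ 2 + ‖mulL2 lam (x - y)‖ ^ 2) with hN
  have n1 : ‖p - q‖ ≤ N := Real.le_sqrt_of_sq_le (by nlinarith [sq_nonneg ‖mulL2 lam (x - y)‖])
  have n2 : ‖mulL2 lam (x - y)‖ ≤ N := Real.le_sqrt_of_sq_le (by nlinarith [sq_nonneg ‖p - q‖])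
  have hQ : 0 ≤ Q := (norm_nonneg _).trans bound_x
  have e : secondDeriv lam m x p - secondDeriv lam m y q =
      2 * ((‖mulL2 lam p‖ ^ 2 - ‖mulL2 lam q‖ ^ 2) - m (‖mulL2 lam x‖ ^ 2) *
        (‖mulL2 (fun ξ => lam ξ ^ 2) x‖ ^ 2 - ‖mulL2 (fun ξ => lam ξ ^ 2) y‖ ^ 2)) := by
    rw [secondDeriv, secondDeriv, hxy]
    ring
  rw [e, norm_mulL2_sq_sub hp₁ hp₂ hq₁ hq₂, norm_mulL2_pow_two_sq_sub hx₁ hx₂ hx₃ hy₁ hy₂ hy₃]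
  have k1 : ∀ {u v z : Lp ℝ 2 μ}, ‖u‖ ≤ Q → ‖v‖ ≤ Q → ‖z‖ ≤ N → |inner ℝ (u + v) z| ≤ 2 * Q * N := by
    intro u v z hu hv hz
    refine (abs_real_inner_le_norm _ _).trans (mul_le_mul ?_ hz (norm_nonneg _) (by positivity))
    exact (norm_add_le _ _).trans (by linarith)
  have k2 := k1 bound_p bound_q n1
  have k3 := k1 bound_x bound_y n2
  rw [abs_mul, abs_two]
  have k4 := abs_sub (inner ℝ (mulL2 (fun ξ => lam ξ ^ 2) p + mulL2 (fun ξ => lam ξ ^ 2) q) (p - q))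
    (m (‖mulL2 lam x‖ ^ 2) * inner ℝ (mulL2 (fun ξ => lam ξ ^ 3) x + mulL2 (fun ξ => lam ξ ^ 3) y)
        (mulL2 lam (x - y)))
  rw [abs_mul] at k4
  have k5 := mul_le_mul hB k3 (abs_nonneg _) ((abs_nonneg _).trans hB)
  linarith

namespace SpectralSolution

variable {lam Φ : M → ℝ} {m : ℝ → ℝ} {r a Q : ℝ} {x p : ℝ → Lp ℝ 2 μ}

theorem hasDerivWithinAt_norm_sq (h : SpectralSolution μ lam Φ m r a Q x p) {t : ℝ}
    (ht : t ∈ Icc 0 a) :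
    HasDerivWithinAt (fun s => ‖mulL2 lam (x s)‖ ^ 2) (firstDeriv lam (x t) (p t)) (Icc 0 a) t := by
  have h1 := HasDerivWithinAt.inner_of_eq_zero
    (F := fun s => mulL2 (fun ξ => lam ξ ^ 2) (x s) + mulL2 (fun ξ => lam ξ ^ 2) (x t))
    ((h.continuousOn t ht).add continuousWithinAt_const) ((h.deriv_x t ht).sub_const (x t))
    (sub_self _)
  have h2 := h1.add_const (‖mulL2 lam (x t)‖ ^ 2)
  refine (h2.congr_of_mem (fun s hs => ?_) ht).congr_deriv ?_
  · rw [← norm_mulL2_sq_sub (h.dom_x₁ s hs) (h.dom_x₂ s hs) (h.dom_x₁ t ht) (h.dom_x₂ t ht)]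
    ring
  · rw [firstDeriv, inner_add_left]
    ring

theorem hasDerivWithinAt_firstDeriv (h : SpectralSolution μ lam Φ m r a Q x p) {t : ℝ}
    (ht : t ∈ Icc 0 a) :
    HasDerivWithinAt (fun s => firstDeriv lam (x s) (p s)) (secondDeriv lam m (x t) (p t))
      (Icc 0 a) t := by
  have h1 := HasDerivWithinAt.inner_of_eq_zero (h.continuousOn t ht)
    ((h.deriv_p t ht).sub_const (p t)) (sub_self _)
  have h2 := HasDerivWithinAt.inner_of_eq_zero
    (F := fun _ => mulL2 (fun ξ => lam ξ ^ 2) (p t)) continuousWithinAt_const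
    ((h.deriv_x t ht).sub_const (x t)) (sub_self _)
  have h3 := ((h1.add h2).const_mul 2).add_const (firstDeriv lam (x t) (p t))
  refine (h3.congr_of_mem (fun s hs => ?_) ht).congr_deriv ?_
  · simp only [firstDeriv, Pi.add_apply, inner_sub_right]
    rw [inner_mulL2_sq_symm (h.dom_p₂ t ht) (h.dom_x₂ s hs),
      inner_mulL2_sq_symm (h.dom_p₂ t ht) (h.dom_x₂ t ht)]
    ring
  · rw [secondDeriv, inner_smul_right, real_inner_self_eq_norm_sq,
      ← norm_mulL2_sq_eq_inner (h.dom_p₁ t ht) (h.dom_p₂ t ht)]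
    ring

theorem continuousOn_x (h : SpectralSolution μ lam Φ m r a Q x p) : ContinuousOn x (Icc 0 a) :=
  fun t ht => (h.deriv_x t ht).continuousWithinAt

theorem continuousOn_p (h : SpectralSolution μ lam Φ m r a Q x p) : ContinuousOn p (Icc 0 a) :=
  fun t ht => (h.deriv_p t ht).continuousWithinAt

theorem continuousOn_secondDeriv (h : SpectralSolution μ lam Φ m r a Q x p)
    (hm : ContinuousOn m (Ici 0)) :
    ContinuousOn (fun t => secondDeriv lam m (x t) (p t)) (Icc 0 a) := by
  have h1 : ContinuousOn (fun t => ‖mulL2 lam (p t)‖ ^ 2) (Icc 0 a) := by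
    intro t ht
    rw [ContinuousWithinAt, tendsto_iff_dist_tendsto_zero]
    have hp : Tendsto (fun s => 2 * Q * ‖p s - p t‖) (𝓝[Icc 0 a] t) (𝓝 0) := by
      have := (tendsto_iff_norm_sub_tendsto_zero.1 (h.continuousOn_p t ht)).const_mul (2 * Q)
      simpa using this
    refine squeeze_zero' (Eventually.of_forall fun _ => dist_nonneg) ?_ hp
    filter_upwards [self_mem_nhdsWithin] with s hs
    rw [Real.dist_eq, norm_mulL2_sq_sub (h.dom_p₁ s hs) (h.dom_p₂ s hs) (h.dom_p₁ t ht)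
      (h.dom_p₂ t ht)]
    refine (abs_real_inner_le_norm _ _).trans (mul_le_mul_of_nonneg_right ?_ (norm_nonneg _))
    exact (norm_add_le _ _).trans (by linarith [h.norm_p₂ s hs, h.norm_p₂ t ht])
  have h2 : ContinuousOn (fun t => m (‖mulL2 lam (x t)‖ ^ 2)) (Icc 0 a) :=
    hm.comp (fun t ht => (h.hasDerivWithinAt_norm_sq ht).continuousWithinAt)
      fun t _ => mem_Ici.2 (sq_nonneg _)
  exact (h1.sub (h2.mul (h.continuousOn.norm.pow 2))).const_mul 2

end SpectralSolution

end SpectralSolution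


/-! ### Energy of the difference of two solutions -/

section EnergyEstimate

variable {M : Type*} [MeasurableSpace M] {μ : Measure M}

/-- Bessel's inequality with the exponential weight, which is constant on each block. -/
theorem sum_norm_mulL2_block_le {κ : M → ℕ} (hκ : Measurable κ) {f Φ : M → ℝ} {w : ℕ → ℝ} {r Q : ℝ}
    (hΦ : ∀ ξ, Φ ξ = w (κ ξ)) {x : Lp ℝ 2 μ} (hf : MulDom f x)
    (hfe : MulDom (fun ξ => f ξ * Real.exp (r * Φ ξ / 2)) x)
    (hQ : ‖mulL2 (fun ξ => f ξ * Real.exp (r * Φ ξ / 2)) x‖ ≤ Q) (n : ℕ) :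
    ∑ k ∈ Finset.range n,
      Real.exp (r * w k) * ‖mulL2 ((κ ⁻¹' {k}).indicator 1) (mulL2 f x)‖ ^ 2 ≤ Q ^ 2 := by
  have h1 : ∀ k, Real.exp (r * w k) * ‖mulL2 ((κ ⁻¹' {k}).indicator 1) (mulL2 f x)‖ ^ 2 =
      ‖mulL2 ((κ ⁻¹' {k}).indicator 1)
        (mulL2 (fun ξ => f ξ * Real.exp (r * Φ ξ / 2)) x)‖ ^ 2 := by
    intro k
    have hmk : Measurable ((κ ⁻¹' {k}).indicator (1 : M → ℝ)) :=
      measurable_one.indicator (hκ (measurableSet_singleton k))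
    have hbk : ∀ ξ, |(κ ⁻¹' {k}).indicator (1 : M → ℝ) ξ| ≤ 1 := fun ξ => by
      by_cases h : ξ ∈ κ ⁻¹' {k} <;> simp [h]
    have e : mulL2 ((κ ⁻¹' {k}).indicator 1)
          (mulL2 (fun ξ => f ξ * Real.exp (r * Φ ξ / 2)) x) =
        Real.exp (r * w k / 2) • mulL2 ((κ ⁻¹' {k}).indicator 1) (mulL2 f x) := by
      refine (mulL2_eq ?_).2
      filter_upwards [coeFn_mulL2 hf, coeFn_mulL2 hfe,
        coeFn_mulL2 (mulDom_of_abs_le hmk hbk (mulL2 f x)),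
        Lp.coeFn_smul (Real.exp (r * w k / 2)) (mulL2 ((κ ⁻¹' {k}).indicator 1) (mulL2 f x))]
        with ξ e1 e2 e3 e4
      rw [e4, Pi.smul_apply, e3, e1, e2, smul_eq_mul]
      by_cases h : ξ ∈ κ ⁻¹' {k}
      · have hk : κ ξ = k := h
        rw [indicator_of_mem h, hΦ, hk]
        simp only [Pi.one_apply]
        ring
      · simp [indicator_of_notMem h]
    rw [e, norm_smul, mul_pow, Real.norm_of_nonneg (Real.exp_pos _).le, ← Real.exp_nat_mul]
    congr 2
    push_cast
    ring
  simp only [h1]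
  have h2 := hasSum_norm_mulL2_indicator hκ (mulL2 (fun ξ => f ξ * Real.exp (r * Φ ξ / 2)) x)
  exact (sum_le_hasSum _ (fun _ _ => sq_nonneg _) h2).trans
    (pow_le_pow_left₀ (norm_nonneg _) hQ 2)

/-- The projections `P k` onto the frequency blocks `{κ = k}`, and the restrictions `B k` to these
blocks of the multiplication by `lam`, which are bounded operators. -/
theorem exists_blockOperators {κ : M → ℕ} (hκ : Measurable κ) {lam : M → ℝ} (hlam : Measurable lam)
    (hlam0 : ∀ ξ, 0 ≤ lam ξ) {b : ℕ → ℝ} (hle : ∀ ξ, lam ξ ≤ b (κ ξ)) (hb0 : ∀ k, 0 ≤ b k) :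
    ∃ P B : ℕ → Lp ℝ 2 μ →L[ℝ] Lp ℝ 2 μ,
      (∀ k u, P k u = mulL2 ((κ ⁻¹' {k}).indicator 1) u) ∧
      (∀ k u, ‖B k u‖ ≤ b k * ‖u‖) ∧
      (∀ k u v, inner ℝ (B k u) v = inner ℝ u (B k v)) ∧
      (∀ k u, B k (P k u) = B k u) ∧
      (∀ k u, MulDom lam u → P k (mulL2 lam u) = B k u) ∧
      ∀ k u, MulDom (fun ξ => lam ξ ^ 2) u → B k (B k u) = P k (mulL2 (fun ξ => lam ξ ^ 2) u) := by
  have hmP : ∀ k, Measurable ((κ ⁻¹' {k}).indicator (1 : M → ℝ)) := fun k =>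
    measurable_one.indicator (hκ (measurableSet_singleton k))
  have hbP : ∀ k ξ, |(κ ⁻¹' {k}).indicator (1 : M → ℝ) ξ| ≤ 1 := fun k ξ => by
    by_cases h : ξ ∈ κ ⁻¹' {k} <;> simp [h]
  have hmB : ∀ k, Measurable ((κ ⁻¹' {k}).indicator lam) := fun k =>
    hlam.indicator (hκ (measurableSet_singleton k))
  have hbB : ∀ k ξ, |(κ ⁻¹' {k}).indicator lam ξ| ≤ b k := fun k ξ => by
    by_cases h : ξ ∈ κ ⁻¹' {k}
    · rw [indicator_of_mem h, abs_of_nonneg (hlam0 ξ)]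
      have hk : κ ξ = k := h
      have := hle ξ
      rwa [hk] at this
    · rw [indicator_of_notMem h, abs_zero]
      exact hb0 k
  obtain ⟨P, hPe⟩ : ∃ P : ℕ → Lp ℝ 2 μ →L[ℝ] Lp ℝ 2 μ,
      ∀ k u, P k u = mulL2 ((κ ⁻¹' {k}).indicator 1) u :=
    ⟨fun k => mulCLM _ (hmP k) 1 zero_le_one (hbP k), fun _ _ => rfl⟩
  obtain ⟨Bk, hBe⟩ : ∃ Bk : ℕ → Lp ℝ 2 μ →L[ℝ] Lp ℝ 2 μ,
      ∀ k u, Bk k u = mulL2 ((κ ⁻¹' {k}).indicator lam) u :=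
    ⟨fun k => mulCLM _ (hmB k) (b k) (hb0 k) (hbB k), fun _ _ => rfl⟩
  have dP : ∀ k (u : Lp ℝ 2 μ), MulDom ((κ ⁻¹' {k}).indicator 1) u := fun k u =>
    mulDom_of_abs_le (hmP k) (hbP k) u
  have dB : ∀ k (u : Lp ℝ 2 μ), MulDom ((κ ⁻¹' {k}).indicator lam) u := fun k u =>
    mulDom_of_abs_le (hmB k) (hbB k) u
  have hBP : ∀ k u, Bk k (P k u) = Bk k u := fun k u => by
    rw [hBe, hPe, hBe]
    refine (mulL2_mulL2 (dP k u) (dB k u) fun ξ => ?_).2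
    by_cases h : ξ ∈ κ ⁻¹' {k} <;> simp [h]
  have hPlam : ∀ k (u : Lp ℝ 2 μ), MulDom lam u → P k (mulL2 lam u) = Bk k u := fun k u hu => by
    rw [hBe, hPe]
    refine (mulL2_mulL2 hu (dB k u) fun ξ => ?_).2
    by_cases h : ξ ∈ κ ⁻¹' {k} <;> simp [h]
  have hBB : ∀ k (u : Lp ℝ 2 μ), MulDom (fun ξ => lam ξ ^ 2) u →
      Bk k (Bk k u) = P k (mulL2 (fun ξ => lam ξ ^ 2) u) := fun k u hu => by
    have d2 : MulDom ((κ ⁻¹' {k}).indicator fun ξ => lam ξ ^ 2) u := by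
      refine mulDom_of_abs_le ((hlam.pow_const 2).indicator (hκ (measurableSet_singleton k)))
        (b := b k ^ 2) (fun ξ => ?_) u
      have := hbB k ξ
      by_cases h : ξ ∈ κ ⁻¹' {k}
      · rw [indicator_of_mem h] at this ⊢
        rw [abs_pow]
        exact pow_le_pow_left₀ (abs_nonneg _) this 2
      · rw [indicator_of_notMem h, abs_zero]
        positivity
    rw [hPe, hBe, hBe, (mulL2_mulL2 (dB k u) d2 fun ξ => ?_).2, (mulL2_mulL2 hu d2 fun ξ => ?_).2]
    · by_cases h : ξ ∈ κ ⁻¹' {k} <;> simp [h]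
    · by_cases h : ξ ∈ κ ⁻¹' {k} <;> simp [h, sq]
  have hBsymm : ∀ k u v, inner ℝ (Bk k u) v = inner ℝ u (Bk k v) := fun k u v => by
    have := inner_mulL2_eq (dB k u) (mulL2_one v).1 (mulL2_one u).1 (dB k v) (fun ξ => mul_comm _ _)
    rw [hBe, hBe]
    rwa [(mulL2_one u).2, (mulL2_one v).2] at this
  refine ⟨P, Bk, hPe, fun k u => ?_, hBsymm, hBP, hPlam, hBB⟩
  rw [hBe]
  exact norm_mulL2_le (hmB k) (hb0 k) (hbB k) u

theorem hasDerivAt_clm_sub {E : Type*} [NormedAddCommGroup E] [NormedSpace ℝ E] (A : E →L[ℝ] E)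
    {f g : ℝ → E} {f' g' : E} {t : ℝ} (hf : HasDerivAt f f' t) (hg : HasDerivAt g g' t) :
    HasDerivAt (fun s => A (f s - g s)) (A (f' - g')) t :=
  A.hasFDerivAt.comp_hasDerivAt t (hf.fun_sub hg)

/-- Let `(x, p)` and `(y, q)` start from the same state and solve the equation with coefficient `c`,
the second one with a time scale whose speed `θ` differs from `1` by at most `η`. Then the energy of
the difference is at most `O(η² t)`. The loss of derivatives due to the low regularity of `c` is
compensated by letting the exponential weight of the energy decrease in time. -/
theorem energy_difference_le {ω φ : ℝ → ℝ} {ν : ℝ} {κ : ℝ → ℕ} {b w : ℕ → ℝ}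
    (hblocks : FrequencyBlocks ω φ ν κ b w) {L B : ℝ} {c : ℝ → ℝ}
    (hc : IsCoefficient ω L ν B c) (hL : 0 ≤ L) (hν : 0 ≤ ν)
    {lam : M → ℝ} (hlam : Measurable lam) (hlam0 : ∀ ξ, 0 ≤ lam ξ) {r : ℝ} (hr : 0 < r) {Q : ℝ} :
    ∃ A δ₀, 0 ≤ A ∧ 0 < δ₀ ∧ ∀ δ ≤ δ₀, ∀ (θ : ℝ → ℝ) (η : ℝ) (x p y q : ℝ → Lp ℝ 2 μ),
      ContinuousOn x (Icc 0 δ) → ContinuousOn p (Icc 0 δ) → ContinuousOn y (Icc 0 δ) →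
      ContinuousOn q (Icc 0 δ) → x 0 = y 0 → p 0 = q 0 →
      (∀ t ∈ Ioo 0 δ, HasDerivAt x (p t) t) →
      (∀ t ∈ Ioo 0 δ, HasDerivAt p (-c t • mulL2 (fun ξ => lam ξ ^ 2) (x t)) t) →
      (∀ t ∈ Ioo 0 δ, HasDerivAt y (θ t • q t) t) →
      (∀ t ∈ Ioo 0 δ, HasDerivAt q (θ t • (-c t • mulL2 (fun ξ => lam ξ ^ 2) (y t))) t) →
      (∀ t ∈ Ioo 0 δ, |1 - θ t| ≤ η) →
      (∀ t ∈ Icc 0 δ, MulDom lam (x t) ∧ MulDom (fun ξ => lam ξ ^ 2) (x t)) →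
      (∀ t ∈ Icc 0 δ, MulDom lam (y t) ∧ MulDom (fun ξ => lam ξ ^ 2) (y t) ∧
        MulDom (fun ξ => lam ξ ^ 2 * Real.exp (r * w (κ (lam ξ)) / 2)) (y t) ∧
        ‖mulL2 (fun ξ => lam ξ ^ 2 * Real.exp (r * w (κ (lam ξ)) / 2)) (y t)‖ ≤ Q) →
      (∀ t ∈ Icc 0 δ, MulDom lam (q t) ∧
        MulDom (fun ξ => lam ξ * Real.exp (r * w (κ (lam ξ)) / 2)) (q t) ∧
        ‖mulL2 (fun ξ => lam ξ * Real.exp (r * w (κ (lam ξ)) / 2)) (q t)‖ ≤ Q) →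
      ∀ t ∈ Icc 0 δ, ‖p t - q t‖ ^ 2 + ‖mulL2 lam (x t - y t)‖ ^ 2 ≤ A * η ^ 2 * t := by
  obtain ⟨K, hK, hsub⟩ := hblocks.substitute L B c hL hc
  have hB : 0 ≤ B := hν.trans ((hc.lower 0).trans (hc.upper 0))
  set K₁ := max 1 (K * (2 / r)) with hK₁
  refine ⟨K₁ * ((B ^ 2 + K) * Q ^ 2), r / (2 * (2 * K + 1)), by positivity, by positivity, ?_⟩
  intro δ hδ θ η x p y q hxc hpc hyc hqc hx0 hp0 hx hp hy hq hθ dx dy dq t ht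
  set k' : M → ℕ := fun ξ => κ (lam ξ) with hk'
  have hk'm : Measurable k' := hblocks.measurable.comp hlam
  obtain ⟨P, Bk, hPe, hBn, hBsymm, hBP, hPlam, hBB⟩ := exists_blockOperators (μ := μ) hk'm hlam
    hlam0 (fun ξ => hblocks.le_b _ (hlam0 ξ)) hblocks.b_nonneg
  choose C C' hC using hsub
  -- the weighted energy of the difference in the block `k`
  set F : ℕ → ℝ → ℝ := fun k s => Real.exp ((r - (2 * K + 1) * s) * w k) *
    (‖P k (p s - q s)‖ ^ 2 + C k s * ‖Bk k (x s - y s)‖ ^ 2) with hF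
  have hFc : ∀ k, ContinuousOn (F k) (Icc 0 δ) := fun k => by
    have h1 : ContinuousOn (C k) (Icc 0 δ) := fun s _ =>
      (hC k s).1.continuousAt.continuousWithinAt
    have h2 : ContinuousOn (fun s => P k (p s - q s)) (Icc 0 δ) :=
      (P k).continuous.comp_continuousOn (hpc.sub hqc)
    have h3 : ContinuousOn (fun s => Bk k (x s - y s)) (Icc 0 δ) :=
      (Bk k).continuous.comp_continuousOn (hxc.sub hyc)
    refine ContinuousOn.mul ?_ ((h2.norm.pow 2).add (h1.mul (h3.norm.pow 2)))
    exact Continuous.continuousOn (by fun_prop)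
  have hF0 : ∀ k, F k 0 = 0 := fun k => by simp [hF, hx0, hp0]
  have hFd : ∀ k, ∀ s ∈ Ioo 0 δ, ∃ D, HasDerivAt (F k) D s ∧ D ≤ Real.exp (r * w k) *
      (η ^ 2 * B ^ 2 * ‖P k (mulL2 (fun ξ => lam ξ ^ 2) (y s))‖ ^ 2 +
        η ^ 2 * K * ‖P k (mulL2 lam (q s))‖ ^ 2) := by
    intro k s hs
    have hs' := Ioo_subset_Icc_self hs
    obtain ⟨c1, c2, c3, c4, c5, c6⟩ := hC k s
    have hX : HasDerivAt (fun s => Bk k (x s - y s))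
        (Bk k (P k (p s - q s)) + (1 - θ s) • Bk k (q s)) s := by
      have h1 := hasDerivAt_clm_sub (Bk k) (hx s hs) (hy s hs)
      refine h1.congr_deriv ?_
      rw [hBP, ← map_smul, ← map_add]
      congr 1
      module
    have hZ : HasDerivAt (fun s => P k (p s - q s))
        (-c s • Bk k (Bk k (x s - y s)) +
          (-((1 - θ s) * c s)) • P k (mulL2 (fun ξ => lam ξ ^ 2) (y s))) s := by
      have h1 := hasDerivAt_clm_sub (P k) (hp s hs) (hq s hs)
      refine h1.congr_deriv ?_
      have d1 := mulL2_sub (dx s hs').2 (dy s hs').2.1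
      rw [hBB k _ d1.1, d1.2, ← map_smul, ← map_smul, ← map_add]
      congr 1
      module
    obtain ⟨D, hD, hDle⟩ := exists_hasDerivAt_blockEnergy (Bk k) (hBsymm k) (r := r)
      (X := fun s => Bk k (x s - y s)) (Z := fun s => P k (p s - q s)) (c := c s)
      (f := (1 - θ s) • Bk k (q s))
      (g := (-((1 - θ s) * c s)) • P k (mulL2 (fun ξ => lam ξ ^ 2) (y s))) (hBn k)
      (hblocks.one_le k) hs.1.le hK hX hZ c1 c2 c3 c5 c6
    refine ⟨D, hD, hDle.trans (mul_le_mul_of_nonneg_left ?_ (Real.exp_pos _).le)⟩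
    have hη := hθ s hs
    have hη2 : (1 - θ s) ^ 2 ≤ η ^ 2 := by
      rw [← sq_abs]; exact pow_le_pow_left₀ (abs_nonneg _) hη 2
    have hc2 : c s ^ 2 ≤ B ^ 2 := pow_le_pow_left₀ (hν.trans (hc.lower s)) (hc.upper s) 2
    rw [norm_smul, norm_smul, mul_pow, mul_pow, Real.norm_eq_abs, Real.norm_eq_abs, sq_abs, sq_abs,
      hPlam k _ (dq s hs').1, neg_sq, mul_pow]
    have e1 := mul_le_mul hη2 hc2 (sq_nonneg _) (sq_nonneg _)
    have e2 := mul_le_mul_of_nonneg_right e1 (sq_nonneg ‖P k (mulL2 (fun ξ => lam ξ ^ 2) (y s))‖)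
    have e3 := mul_le_mul_of_nonneg_right hη2
      (mul_nonneg hK.le (sq_nonneg ‖Bk k (q s)‖))
    linarith
  have htot : ∀ n, ∑ k ∈ Finset.range n, F k t ≤ η ^ 2 * ((B ^ 2 + K) * Q ^ 2) * t := by
    intro n
    choose! D hD using hFd
    have h1 := image_sub_le_of_hasDerivAt_le (f := fun s => ∑ k ∈ Finset.range n, F k s)
      (f' := fun s => ∑ k ∈ Finset.range n, D k s) (C := η ^ 2 * ((B ^ 2 + K) * Q ^ 2)) ht.1
      (continuousOn_finsetSum _ fun k _ => (hFc k).mono (Icc_subset_Icc_right ht.2))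
      (fun s hs => HasDerivAt.fun_sum fun k _ => (hD k s ⟨hs.1, hs.2.trans_le ht.2⟩).1)
      (fun s hs => by
        have hs1 : s ∈ Ioo 0 δ := ⟨hs.1, hs.2.trans_le ht.2⟩
        have hs' := Ioo_subset_Icc_self hs1
        refine (Finset.sum_le_sum fun k _ => (hD k s hs1).2).trans ?_
        have a1 := sum_norm_mulL2_block_le hk'm (w := w) (r := r) (fun ξ => rfl)
          (dy s hs').2.1 (dy s hs').2.2.1 (dy s hs').2.2.2 n
        have a2 := sum_norm_mulL2_block_le hk'm (w := w) (r := r) (fun ξ => rfl)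
          (dq s hs').1 (dq s hs').2.1 (dq s hs').2.2 n
        have a3 := mul_le_mul_of_nonneg_left a1 (a := η ^ 2 * B ^ 2) (by positivity)
        have a4 := mul_le_mul_of_nonneg_left a2 (a := η ^ 2 * K) (by positivity)
        rw [Finset.mul_sum] at a3 a4
        have a5 := add_le_add a3 a4
        rw [← Finset.sum_add_distrib] at a5
        refine le_trans (le_of_eq (Finset.sum_congr rfl fun k _ => ?_)) (a5.trans (le_of_eq ?_))
        · rw [hPe, hPe]; ring
        · ring)
    simpa [hF0] using h1
  -- for `t ≤ δ₀` the weight is at least `exp (r / 2 * w k)`, which compensates for `1 / C k`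
  have hle : ∀ k, ‖P k (p t - q t)‖ ^ 2 + ‖P k (mulL2 lam (x t - y t))‖ ^ 2 ≤ K₁ * F k t := by
    intro k
    obtain ⟨c1, c2, c3, c4, c5, c6⟩ := hC k t
    rw [hPlam k _ (mulL2_sub (dx t ht).1 (dy t ht).1).1]
    have hw0 : 0 < w k := zero_lt_one.trans_le (hblocks.one_le k)
    set e := Real.exp ((r - (2 * K + 1) * t) * w k) with he
    have h1 : r / 2 * w k ≤ (r - (2 * K + 1) * t) * w k := by
      refine mul_le_mul_of_nonneg_right ?_ hw0.le
      have h2 := ht.2.trans hδ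
      rw [le_div_iff₀ (by positivity)] at h2
      linarith
    have h2 : 1 + r / 2 * w k ≤ e := by
      have := Real.add_one_le_exp (r / 2 * w k)
      have := Real.exp_le_exp.2 h1
      linarith
    have h3 : 0 < r / 2 * w k := by positivity
    have h4 : 1 ≤ K₁ * e := by
      have : 1 * 1 ≤ K₁ * e := mul_le_mul (le_max_left _ _) (by linarith) zero_le_one
        (zero_le_one.trans (le_max_left _ _))
      linarith
    have h5 : 1 ≤ K₁ * e * C k t := by
      refine c4.trans (mul_le_mul_of_nonneg_right ?_ c2.le)
      have h6 : K * w k = K * (2 / r) * (r / 2 * w k) := by field_simp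
      rw [h6]
      exact mul_le_mul (le_max_right _ _) (by linarith) h3.le
        (zero_le_one.trans (le_max_left _ _))
    have h7 := mul_le_mul_of_nonneg_right h4 (sq_nonneg ‖P k (p t - q t)‖)
    have h8 := mul_le_mul_of_nonneg_right h5 (sq_nonneg ‖Bk k (x t - y t)‖)
    simp only [hF]
    linarith
  have hs1 := (hasSum_norm_mulL2_indicator hk'm (p t - q t)).add
    (hasSum_norm_mulL2_indicator hk'm (mulL2 lam (x t - y t)))
  simp only [← hPe] at hs1
  refine le_of_tendsto' hs1.tendsto_sum_nat fun n => ?_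
  refine (Finset.sum_le_sum fun k _ => hle k).trans ?_
  rw [← Finset.mul_sum]
  refine (mul_le_mul_of_nonneg_left (htot n) (zero_le_one.trans (le_max_left _ _))).trans_eq ?_
  ring

end EnergyEstimate


/-! ### Local uniqueness in the spectral representation -/

section LocalUniqueness

variable {M : Type*} [MeasurableSpace M] {μ : Measure M}

/-- The coefficient `m(‖lam x‖²)` along a solution has the modulus of continuity `ω` up to a constant,
as `‖lam x‖²` is Lipschitz. It is extended to all times by its values at the end points. -/
theorem SpectralSolution.exists_isCoefficient {ω m : ℝ → ℝ} {ν : ℝ} (hω : IsContinuityModulus ω)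
    (hm : IsOmegaContinuous ω m) (hmν : ∀ s, 0 ≤ s → ν ≤ m s) {lam Φ : M → ℝ} {r a Q : ℝ}
    {x p : ℝ → Lp ℝ 2 μ} (ha : 0 ≤ a) (h : SpectralSolution μ lam Φ m r a Q x p) :
    ∃ L B c, 0 ≤ L ∧ IsCoefficient ω L ν B c ∧ ∀ t ∈ Icc 0 a, c t = m (‖mulL2 lam (x t)‖ ^ 2) := by
  have hmc := hm.continuousOn hω
  obtain ⟨L, hL⟩ := hm
  set ψ : ℝ → ℝ := fun t => ‖mulL2 lam (x t)‖ ^ 2 with hψ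
  have hψc : ContinuousOn ψ (Icc 0 a) := fun t ht => (h.hasDerivWithinAt_norm_sq ht).continuousWithinAt
  have hψ1 : ContinuousOn (fun t => firstDeriv lam (x t) (p t)) (Icc 0 a) := fun t ht =>
    (h.hasDerivWithinAt_firstDeriv ht).continuousWithinAt
  obtain ⟨ℓ, hℓ⟩ := isCompact_Icc.exists_bound_of_continuousOn hψ1
  obtain ⟨B, hB⟩ := isCompact_Icc.exists_bound_of_continuousOn
    (hmc.comp hψc fun t _ => mem_Ici.2 (sq_nonneg _))
  have hℓ0 : 0 ≤ ℓ := (norm_nonneg _).trans (hℓ 0 (left_mem_Icc.2 ha))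
  have hlip : ∀ s ∈ Icc 0 a, ∀ t ∈ Icc 0 a, |ψ s - ψ t| ≤ ℓ * |s - t| := fun s hs t ht =>
    (convex_Icc 0 a).norm_image_sub_le_of_norm_hasDerivWithin_le
      (fun r hr => h.hasDerivWithinAt_norm_sq hr) hℓ ht hs
  refine ⟨|L| * (ℓ + 1), B, fun t => m (ψ (projIcc 0 a ha t)), by positivity,
    ⟨fun s t => ?_, fun t => hmν _ (sq_nonneg _), fun t => ?_⟩, fun t ht => ?_⟩
  · set s' : ℝ := ((projIcc 0 a ha s : Icc (0 : ℝ) a) : ℝ)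
    set t' : ℝ := ((projIcc 0 a ha t : Icc (0 : ℝ) a) : ℝ)
    have h1 : |ψ s' - ψ t'| ≤ ℓ * |s - t| :=
      (hlip _ (projIcc 0 a ha s).2 _ (projIcc 0 a ha t).2).trans
        (mul_le_mul_of_nonneg_left (abs_projIcc_sub_projIcc ha) hℓ0)
    have h2 : ω |ψ s' - ψ t'| ≤ (ℓ + 1) * ω |s - t| :=
      (hω.monotoneOn (mem_Ici.2 (abs_nonneg _)) (mem_Ici.2 (by positivity)) h1).trans
        (hω.mul_le hℓ0 (abs_nonneg _))
    have h3 := hω.nonneg _ (abs_nonneg (ψ s' - ψ t'))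
    calc |m (ψ s') - m (ψ t')| ≤ L * ω |ψ s' - ψ t'| := hL _ _ (sq_nonneg _) (sq_nonneg _)
      _ ≤ |L| * ω |ψ s' - ψ t'| := mul_le_mul_of_nonneg_right (le_abs_self L) h3
      _ ≤ |L| * ((ℓ + 1) * ω |s - t|) := mul_le_mul_of_nonneg_left h2 (abs_nonneg L)
      _ = |L| * (ℓ + 1) * ω |s - t| := by ring
  · exact (le_abs_self _).trans (hB _ (projIcc 0 a ha t).2)
  · simp only [projIcc_of_mem ha ht, hψ]

/-- Local uniqueness for non-degenerate data. The time change `τ` with `‖lam y(τ)‖² = ‖lam x‖²`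
makes both equations have the same coefficient; a bound `η` for `|1 - τ'|` gives a bound for the
energy of the difference, and this in turn improves the bound for `|1 - τ'|` to `η / 2`. -/
theorem SpectralSolution.exists_eqOn {ω φ m : ℝ → ℝ} {ν : ℝ} {κ : ℝ → ℕ} {b w : ℕ → ℝ}
    (hblocks : FrequencyBlocks ω φ ν κ b w) (hω : IsContinuityModulus ω)
    (hm : IsOmegaContinuous ω m) (hν : 0 ≤ ν) (hmν : ∀ s, 0 ≤ s → ν ≤ m s)
    {lam : M → ℝ} (hlam : Measurable lam) (hlam0 : ∀ ξ, 0 ≤ lam ξ) {r a Q : ℝ} (hr : 0 < r)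
    (ha : 0 < a) {x p y q : ℝ → Lp ℝ 2 μ}
    (hx : SpectralSolution μ lam (fun ξ => w (κ (lam ξ))) m r a Q x p)
    (hy : SpectralSolution μ lam (fun ξ => w (κ (lam ξ))) m r a Q y q)
    (h0 : x 0 = y 0) (h1 : p 0 = q 0)
    (hne : firstDeriv lam (x 0) (p 0) ≠ 0 ∨ secondDeriv lam m (x 0) (p 0) ≠ 0) :
    ∃ δ ∈ Ioc 0 a, ∀ t ∈ Icc 0 δ, x t = y t := by
  have hmc := hm.continuousOn hω
  obtain ⟨δ₁, hδ₁, τ, C, hC, hτ0, hτc, hτ, hτd, hest⟩ := exists_time_change ha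
    (fun t ht => hx.hasDerivWithinAt_norm_sq ht) (fun t ht => hx.hasDerivWithinAt_firstDeriv ht)
    (hx.continuousOn_secondDeriv hmc) (fun t ht => hy.hasDerivWithinAt_norm_sq ht)
    (fun t ht => hy.hasDerivWithinAt_firstDeriv ht) (hy.continuousOn_secondDeriv hmc)
    (by rw [h0]) (by rw [h0, h1]) (by rw [h0, h1]) hne
  obtain ⟨L, B, c, hL, hc, hcm⟩ := hx.exists_isCoefficient hω hm hmν ha.le
  have hB : 0 ≤ B := hν.trans ((hc.lower 0).trans (hc.upper 0))
  have hQ : 0 ≤ Q := (norm_nonneg _).trans (hx.norm_x₃ 0 (left_mem_Icc.2 ha.le))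
  obtain ⟨A, δ₀, hA, hδ₀, henergy⟩ := energy_difference_le (μ := μ) hblocks hc hL hν hlam hlam0 hr
    (Q := Q)
  set θ : ℝ → ℝ := fun t => firstDeriv lam (x t) (p t) / firstDeriv lam (y (τ t)) (q (τ t)) with hθ
  set G := 4 * Q * (1 + B) with hG
  have hG0 : 0 ≤ G := by positivity
  set δ := min δ₁ (min δ₀ (1 / (4 * ((C * G) ^ 2 * A + 1)))) with hδ
  have hδ0 : 0 < δ := lt_min hδ₁.1 (lt_min hδ₀ (by positivity))
  have hδδ₁ : δ ≤ δ₁ := min_le_left _ _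
  have hδδ₀ : δ ≤ δ₀ := (min_le_right _ _).trans (min_le_left _ _)
  have hsmall : C * G * √(A * δ) ≤ 1 / 2 := by
    refine abs_le_of_sq_le_sq' ?_ (by norm_num) |>.2
    rw [mul_pow, Real.sq_sqrt (by positivity)]
    have h2 : δ ≤ 1 / (4 * ((C * G) ^ 2 * A + 1)) := (min_le_right _ _).trans (min_le_right _ _)
    rw [le_div_iff₀ (by positivity)] at h2
    nlinarith
  have hI₁ : Icc 0 δ ⊆ Icc 0 δ₁ := Icc_subset_Icc_right hδδ₁
  have hIa : Icc 0 δ ⊆ Icc 0 a := Icc_subset_Icc_right (hδδ₁.trans hδ₁.2)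
  have hIoo : ∀ t ∈ Ioo 0 δ, t ∈ Ioo 0 δ₁ := fun t ht => ⟨ht.1, ht.2.trans_le hδδ₁⟩
  have hIooa : ∀ t ∈ Ioo 0 δ, Icc 0 a ∈ 𝓝 t := fun t ht =>
    Icc_mem_nhds ht.1 (ht.2.trans_le (hδδ₁.trans hδ₁.2))
  have hτa : ∀ t ∈ Icc 0 δ, τ t ∈ Icc 0 a := fun t ht => (hτ t (hI₁ ht)).1
  have hE : ∀ η, (∀ t ∈ Ioo 0 δ, |1 - θ t| ≤ η) → ∀ t ∈ Icc 0 δ,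
      ‖p t - q (τ t)‖ ^ 2 + ‖mulL2 lam (x t - y (τ t))‖ ^ 2 ≤ A * η ^ 2 * t := by
    intro η hη
    refine henergy δ hδδ₀ θ η x p (fun t => y (τ t)) (fun t => q (τ t)) (hx.continuousOn_x.mono hIa)
      (hx.continuousOn_p.mono hIa) (hy.continuousOn_x.comp (hτc.mono hI₁) hτa)
      (hy.continuousOn_p.comp (hτc.mono hI₁) hτa) (by rw [hτ0, h0]) (by rw [hτ0, h1])
      (fun t ht => ?_) (fun t ht => ?_) (fun t ht => ?_) (fun t ht => ?_) hη
      (fun t ht => ⟨hx.dom_x₁ t (hIa ht), hx.dom_x₂ t (hIa ht)⟩)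
      (fun t ht => ⟨hy.dom_x₁ _ (hτa t ht), hy.dom_x₂ _ (hτa t ht), hy.dom_exp_x _ (hτa t ht),
        hy.norm_exp_x _ (hτa t ht)⟩)
      (fun t ht => ⟨hy.dom_p₁ _ (hτa t ht), hy.dom_exp_p _ (hτa t ht), hy.norm_exp_p _ (hτa t ht)⟩)
    · exact (hx.deriv_x t (hIa (Ioo_subset_Icc_self ht))).hasDerivAt (hIooa t ht)
    · rw [hcm t (hIa (Ioo_subset_Icc_self ht))]
      exact (hx.deriv_p t (hIa (Ioo_subset_Icc_self ht))).hasDerivAt (hIooa t ht)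
    · obtain ⟨k1, k2⟩ := hτd t (hIoo t ht)
      exact ((hy.deriv_x _ (Ioo_subset_Icc_self k1)).hasDerivAt
        (Icc_mem_nhds k1.1 k1.2)).scomp t k2
    · obtain ⟨k1, k2⟩ := hτd t (hIoo t ht)
      have k3 := ((hy.deriv_p _ (Ioo_subset_Icc_self k1)).hasDerivAt
        (Icc_mem_nhds k1.1 k1.2)).scomp t k2
      rw [hcm t (hIa (Ioo_subset_Icc_self ht)), ← (hτ t (hI₁ (Ioo_subset_Icc_self ht))).2]
      exact k3
  have hcontract : ∀ η, 0 ≤ η → (∀ t ∈ Ioo 0 δ, |1 - θ t| ≤ η) →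
      ∀ t ∈ Ioo 0 δ, |1 - θ t| ≤ η / 2 := by
    intro η hη0 hη t ht
    -- `C * G * √(A * δ) ≤ 1 / 2` by the choice of `δ`
    have h2 := hest t (hIoo t ht) (G * (√(A * δ) * η)) fun s hs => by
      have hs' : s ∈ Icc 0 δ := ⟨hs.1.le, hs.2.le.trans ht.2.le⟩
      have hsa := hIa hs'
      have hτs := hτa s hs'
      have e := hE η hη s hs'
      have hmB : |m (‖mulL2 lam (x s)‖ ^ 2)| ≤ B := by
        rw [← hcm s hsa, abs_of_nonneg (hν.trans (hc.lower s))]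
        exact hc.upper s
      refine (abs_secondDeriv_sub_le (hx.dom_x₁ s hsa) (hx.dom_x₂ s hsa) (hx.dom_x₃ s hsa)
        (hx.dom_p₁ s hsa) (hx.dom_p₂ s hsa) (hy.dom_x₁ _ hτs) (hy.dom_x₂ _ hτs) (hy.dom_x₃ _ hτs)
        (hy.dom_p₁ _ hτs) (hy.dom_p₂ _ hτs) (hx.norm_x₃ s hsa) (hy.norm_x₃ _ hτs)
        (hx.norm_p₂ s hsa) (hy.norm_p₂ _ hτs) (hτ s (hI₁ hs')).2 hmB).trans ?_
      refine mul_le_mul_of_nonneg_left ?_ hG0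
      rw [← Real.sqrt_sq hη0]
      rw [← Real.sqrt_mul (by positivity)]
      refine Real.sqrt_le_sqrt (e.trans ?_)
      have : A * η ^ 2 * s ≤ A * η ^ 2 * δ := mul_le_mul_of_nonneg_left hs'.2 (by positivity)
      linarith
    refine h2.trans ?_
    have := mul_le_mul_of_nonneg_right hsmall hη0
    linarith
  obtain ⟨η₀, hη₀0, hη₀⟩ : ∃ η₀, 0 ≤ η₀ ∧ ∀ t ∈ Ioo 0 δ, |1 - θ t| ≤ η₀ := by
    have k1 : ContinuousOn (fun s => secondDeriv lam m (x s) (p s) -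
        secondDeriv lam m (y (τ s)) (q (τ s))) (Icc 0 δ₁) :=
      ((hx.continuousOn_secondDeriv hmc).mono (Icc_subset_Icc_right hδ₁.2)).sub
        ((hy.continuousOn_secondDeriv hmc).comp hτc fun s hs => (hτ s hs).1)
    obtain ⟨R, hR⟩ := isCompact_Icc.exists_bound_of_continuousOn k1
    have hR0 : 0 ≤ R := (norm_nonneg _).trans (hR 0 (left_mem_Icc.2 hδ₁.1.le))
    refine ⟨C * R, by positivity, fun t ht => hest t (hIoo t ht) R fun s hs => ?_⟩
    exact hR s ⟨hs.1.le, hs.2.le.trans (hIoo t ht).2.le⟩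
  have hiter : ∀ n : ℕ, ∀ t ∈ Ioo 0 δ, |1 - θ t| ≤ η₀ * (1 / 2) ^ n := by
    intro n
    induction n with
    | zero => simpa using hη₀
    | succ n ih =>
      intro t ht
      refine (hcontract _ (by positivity) ih t ht).trans_eq ?_
      rw [pow_succ]; ring
  have hzero : ∀ t ∈ Ioo 0 δ, |1 - θ t| ≤ 0 := fun t ht => by
    have h2 : Tendsto (fun n : ℕ => η₀ * (1 / 2 : ℝ) ^ n) atTop (𝓝 (η₀ * 0)) :=
      (tendsto_pow_atTop_nhds_zero_of_lt_one (by norm_num) (by norm_num)).const_mul _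
    rw [mul_zero] at h2
    exact ge_of_tendsto' h2 fun n => hiter n t ht
  have hθ1 : ∀ t ∈ Ioo 0 δ, HasDerivAt τ 1 t := fun t ht => by
    have h2 := abs_nonpos_iff.1 (hzero t ht)
    have h3 := (hτd t (hIoo t ht)).2
    rwa [show firstDeriv lam (x t) (p t) / firstDeriv lam (y (τ t)) (q (τ t)) = 1 by
      change θ t = 1; linarith] at h3
  have hid : ∀ t ∈ Icc 0 δ, τ t = t := fun t ht => by
    have hsub : Icc 0 t ⊆ Icc 0 δ₁ := (Icc_subset_Icc_right ht.2).trans hI₁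
    have k1 := image_sub_le_of_hasDerivAt_le (C := 1) ht.1 (hτc.mono hsub)
      (fun s hs => hθ1 s ⟨hs.1, hs.2.trans_le ht.2⟩) fun _ _ => le_rfl
    have k2 := image_sub_le_of_hasDerivAt_le (C := -1) ht.1 (hτc.mono hsub).neg
      (fun s hs => (hθ1 s ⟨hs.1, hs.2.trans_le ht.2⟩).neg) fun _ _ => le_rfl
    simp only [Pi.neg_apply, hτ0] at k1 k2
    linarith
  have hpq : ∀ t ∈ Icc 0 δ, p t = q t := fun t ht => by
    have h2 := hE 0 hzero t ht
    rw [hid t ht] at h2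
    have h3 : ‖p t - q t‖ ^ 2 ≤ 0 := by nlinarith [sq_nonneg ‖mulL2 lam (x t - y t)‖]
    have h4 : ‖p t - q t‖ = 0 := by nlinarith [norm_nonneg (p t - q t)]
    exact sub_eq_zero.1 (norm_eq_zero.1 h4)
  refine ⟨δ, ⟨hδ0, hδδ₁.trans hδ₁.2⟩, fun t ht => ?_⟩
  have hconst := constant_of_has_deriv_right_zero (f := fun t => x t - y t) (a := 0) (b := δ)
    ((hx.continuousOn_x.mono hIa).sub (hy.continuousOn_x.mono hIa)) (fun s hs => by
      have hs' : s ∈ Icc 0 δ := ⟨hs.1, hs.2.le⟩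
      have h2 := (hx.deriv_x s (hIa hs')).fun_sub (hy.deriv_x s (hIa hs'))
      rw [hpq s hs', sub_self] at h2
      refine h2.mono_of_mem_nhdsWithin (mem_of_superset (Ico_mem_nhdsGE
        (hs.2.trans_le (hδδ₁.trans hδ₁.2))) fun u hu => ⟨hs.1.trans hu.1, hu.2.le⟩)) t ht
  rw [h0, sub_self] at hconst
  exact sub_eq_zero.1 hconst

end LocalUniqueness


/-! ### Passage to the spectral representation -/

theorem continuousOn_mulL2_of_abs_le {M : Type*} [MeasurableSpace M] {μ : Measure M}
    {f g : M → ℝ} {a b : ℝ} (hf : Measurable f) (ha : 0 ≤ a) (hb : 0 ≤ b)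
    (h : ∀ ξ, |f ξ| ≤ a * |g ξ| + b) {x : ℝ → Lp ℝ 2 μ} {s : Set ℝ} (hx : ContinuousOn x s)
    (hd : ∀ t ∈ s, MulDom g (x t)) (hg : ContinuousOn (fun t => mulL2 g (x t)) s) :
    ContinuousOn (fun t => mulL2 f (x t)) s := by
  intro t ht
  rw [ContinuousWithinAt, tendsto_iff_norm_sub_tendsto_zero]
  have h1 := tendsto_iff_norm_sub_tendsto_zero.1 (hg t ht)
  have h2 := tendsto_iff_norm_sub_tendsto_zero.1 (hx t ht)
  have h3 := (h1.const_mul a).add (h2.const_mul b)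
  rw [mul_zero, mul_zero, add_zero] at h3
  refine squeeze_zero' (Eventually.of_forall fun _ => norm_nonneg _) ?_ h3
  filter_upwards [self_mem_nhdsWithin] with r hr
  have d := mulL2_sub (hd r hr) (hd t ht)
  have k := norm_mulL2_le_of_abs_le hf ha hb d.1 h
  have df : ∀ t ∈ s, MulDom f (x t) := fun t ht =>
    (norm_mulL2_le_of_abs_le hf ha hb (hd t ht) h).1
  rw [← (mulL2_sub (df r hr) (df t ht)).2, ← d.2]
  exact k.2

section Transfer

variable {H : Type*} [NormedAddCommGroup H] [InnerProductSpace ℝ H] {A : H →ₗ.[ℝ] H}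

theorem spectralIntegral_eq (h : Nonempty (SpectralRepresentation A)) (w : ℝ → ℝ≥0∞) (u : H) :
    spectralIntegral A w u =
      ∫⁻ ξ, w (h.some.lam ξ) * ENNReal.ofReal (h.some.U u ξ ^ 2) ∂h.some.μ :=
  dif_pos h

/-- Without a spectral representation the Gevrey spaces are empty by convention; so the spectral
theorem is not needed. -/
theorem nonempty_spectralRepresentation {φ : ℝ → ℝ} {r α : ℝ} {u : H} (hu : u ∈ gevrey A φ r α) :
    Nonempty (SpectralRepresentation A) := by
  by_contra h
  have h1 : gevreySq A φ r α u < ⊤ := hu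
  rw [gevreySq, spectralIntegral, dif_neg h] at h1
  exact lt_irrefl _ h1

/-- The weight of a Gevrey space may be lowered. No measurability is required: the Lebesgue
integral of an arbitrary function is monotone. -/
theorem gevreySq_mono (h : Nonempty (SpectralRepresentation A)) {φ Φ : ℝ → ℝ}
    (hΦ : ∀ l, 0 ≤ l → Φ l ≤ φ l) {r : ℝ} (hr : 0 ≤ r) (α : ℝ) (u : H) :
    gevreySq A Φ r α u ≤ gevreySq A φ r α u := by
  rw [gevreySq, gevreySq, spectralIntegral_eq h, spectralIntegral_eq h]
  refine lintegral_mono fun ξ => ?_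
  have h0 := h.some.lam_nonneg ξ
  have h1 := hΦ _ h0
  have h2 := Real.rpow_nonneg h0 (4 * α)
  gcongr

theorem ContGevrey.mono (h : Nonempty (SpectralRepresentation A)) {φ Φ : ℝ → ℝ}
    (hΦ : ∀ l, 0 ≤ l → Φ l ≤ φ l) {r α T : ℝ} (hr : 0 ≤ r) {f : ℝ → H}
    (hf : ContGevrey A φ r α T f) : ContGevrey A Φ r α T f := fun t ht =>
  ⟨(gevreySq_mono h hΦ hr α _).trans_lt (hf t ht).1,
    tendsto_of_tendsto_of_tendsto_of_le_of_le tendsto_const_nhds (hf t ht).2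
      (fun _ => bot_le) fun _ => add_le_add_right (gevreySq_mono h hΦ hr α _) _⟩

theorem tendsto_zero_of_gevreyNormSq {φ : ℝ → ℝ} {r α : ℝ} {l : Filter ℝ} {f : ℝ → H}
    (hf : Tendsto (fun s => gevreyNormSq A φ r α (f s)) l (𝓝 0)) :
    Tendsto f l (𝓝 0) ∧ Tendsto (fun s => gevreySq A φ r α (f s)) l (𝓝 0) := by
  refine ⟨?_, tendsto_of_tendsto_of_tendsto_of_le_of_le tendsto_const_nhds hf
    (fun _ => bot_le) fun s => le_add_self⟩
  have h1 : Tendsto (fun s => ENNReal.ofReal (‖f s‖ ^ 2)) l (𝓝 0) :=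
    tendsto_of_tendsto_of_tendsto_of_le_of_le tendsto_const_nhds hf
      (fun _ => bot_le) fun s => le_self_add
  have h2 := (ENNReal.tendsto_toReal ENNReal.zero_ne_top).comp h1
  have h3 : Tendsto (fun s => ‖f s‖ ^ 2) l (𝓝 0) := by
    refine h2.congr fun s => ?_
    rw [Function.comp, ENNReal.toReal_ofReal (sq_nonneg _)]
  have h4 := (Real.continuous_sqrt.tendsto 0).comp h3
  rw [Real.sqrt_zero] at h4
  rw [tendsto_zero_iff_norm_tendsto_zero]
  refine h4.congr fun s => ?_
  rw [Function.comp, Real.sqrt_sq (norm_nonneg _)]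

theorem HasDerivGevrey.hasDerivWithinAt {φ : ℝ → ℝ} {r α T : ℝ} {f f' : ℝ → H}
    (hf : HasDerivGevrey A φ r α T f f') {t : ℝ} (ht : t ∈ Icc 0 T) :
    HasDerivWithinAt f (f' t) (Icc 0 T) t := by
  rw [hasDerivWithinAt_iff_tendsto_slope]
  have h := (tendsto_zero_of_gevreyNormSq (hf t ht)).1.add_const (f' t)
  rw [zero_add] at h
  refine h.congr fun s => ?_
  rw [sub_add_cancel, slope, vsub_eq_sub]

theorem ContGevrey.continuousOn {φ : ℝ → ℝ} {r α T : ℝ} {f : ℝ → H}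
    (hf : ContGevrey A φ r α T f) : ContinuousOn f (Icc 0 T) := fun t ht => by
  have h := (tendsto_zero_of_gevreyNormSq (hf t ht).2).1.add_const (f t)
  rw [zero_add] at h
  exact h.congr fun s => sub_add_cancel _ _

theorem ContGevrey.congr {φ : ℝ → ℝ} {r α T : ℝ} {f g : ℝ → H}
    (hf : ContGevrey A φ r α T f) (hfg : ∀ t ∈ Icc 0 T, f t = g t) : ContGevrey A φ r α T g := by
  intro t ht
  refine ⟨hfg t ht ▸ (hf t ht).1, (hf t ht).2.congr' ?_⟩
  filter_upwards [self_mem_nhdsWithin] with s hs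
  rw [hfg t ht, hfg s hs]

/-- The derivatives in the various Gevrey norms all coincide with the derivatives in `H`. -/
theorem SolutionClass.regularity {φ : ℝ → ℝ} {r T : ℝ} (hT : 0 < T) {v : ℝ → H}
    (hv : SolutionClass A φ r T v) :
    (∀ t ∈ Icc 0 T, HasDerivWithinAt v (derivWithin v (Icc 0 T) t) (Icc 0 T) t) ∧
    (∀ t ∈ Icc 0 T, HasDerivWithinAt (derivWithin v (Icc 0 T))
      (derivWithin (derivWithin v (Icc 0 T)) (Icc 0 T) t) (Icc 0 T) t) ∧
    ContGevrey A φ r (3 / 2) T v ∧ ContGevrey A φ r 1 T (derivWithin v (Icc 0 T)) := by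
  obtain ⟨⟨-, f', hf', -, f'', hf'', -⟩, ⟨-, g', hg', hg'c⟩, h0⟩ := hv
  have hu := uniqueDiffOn_Icc hT
  have e1 : ∀ t ∈ Icc 0 T, derivWithin v (Icc 0 T) t = f' t := fun t ht =>
    (hf'.hasDerivWithinAt ht).derivWithin (hu t ht)
  have e2 : ∀ t ∈ Icc 0 T, derivWithin v (Icc 0 T) t = g' t := fun t ht =>
    (hg'.hasDerivWithinAt ht).derivWithin (hu t ht)
  refine ⟨fun t ht => (hf'.hasDerivWithinAt ht).differentiableWithinAt.hasDerivWithinAt,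
    fun t ht => ?_, h0, ContGevrey.congr hg'c fun t ht => (e2 t ht).symm⟩
  exact ((hf''.hasDerivWithinAt ht).congr_of_mem e1 ht).differentiableWithinAt.hasDerivWithinAt

/-- The exponent `4 * α` is an even natural number for all Gevrey spaces in use, and the integrand of
the seminorm is then the square of `lam ^ j * exp (r * φ / 2) * U u`. -/
theorem gevreySq_eq_lintegral (h : Nonempty (SpectralRepresentation A)) {φ : ℝ → ℝ} {r α : ℝ}
    {j : ℕ} (hj : 4 * α = ((2 * j : ℕ) : ℝ)) (u : H) :
    gevreySq A φ r α u = ∫⁻ ξ, ENNReal.ofReal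
      ((h.some.lam ξ ^ j * Real.exp (r * φ (h.some.lam ξ) / 2) * h.some.U u ξ) ^ 2) ∂h.some.μ := by
  rw [gevreySq, spectralIntegral_eq h]
  refine lintegral_congr fun ξ => ?_
  rw [hj, Real.rpow_natCast, ← ENNReal.ofReal_mul (by have := h.some.lam_nonneg ξ; positivity)]
  congr 1
  rw [mul_pow, mul_pow, ← Real.exp_nat_mul, pow_mul', Nat.cast_two, mul_div_cancel₀ _ two_ne_zero]

theorem norm_mulL2_sq_eq_gevreySq (h : Nonempty (SpectralRepresentation A)) {φ : ℝ → ℝ}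
    (hφ : Measurable φ) {r α : ℝ} {j : ℕ} (hj : 4 * α = ((2 * j : ℕ) : ℝ)) {u : H}
    (hu : u ∈ gevrey A φ r α) :
    MulDom (fun ξ => h.some.lam ξ ^ j * Real.exp (r * φ (h.some.lam ξ) / 2)) (h.some.U u) ∧
    ENNReal.ofReal (‖mulL2 (fun ξ => h.some.lam ξ ^ j * Real.exp (r * φ (h.some.lam ξ) / 2))
      (h.some.U u)‖ ^ 2) = gevreySq A φ r α u := by
  have hm := h.some.measurable_lam
  have hd : MulDom (fun ξ => h.some.lam ξ ^ j * Real.exp (r * φ (h.some.lam ξ) / 2))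
      (h.some.U u) := by
    refine mulDom_of_lintegral_lt_top
      ((hm.pow_const j).mul ((((hφ.comp hm).const_mul r).div_const 2).exp)) ?_
    have h1 : gevreySq A φ r α u < ⊤ := hu
    rwa [gevreySq_eq_lintegral h hj] at h1
  exact ⟨hd, by rw [norm_mulL2_sq hd, gevreySq_eq_lintegral h hj]⟩

theorem ContGevrey.continuousOn_mulL2 (h : Nonempty (SpectralRepresentation A)) {φ : ℝ → ℝ}
    (hφ : Measurable φ) {r α T : ℝ} {j : ℕ} (hj : 4 * α = ((2 * j : ℕ) : ℝ)) {f : ℝ → H}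
    (hf : ContGevrey A φ r α T f) :
    ContinuousOn (fun t => mulL2 (fun ξ => h.some.lam ξ ^ j *
      Real.exp (r * φ (h.some.lam ξ) / 2)) (h.some.U (f t))) (Icc 0 T) := by
  set g := fun ξ => h.some.lam ξ ^ j * Real.exp (r * φ (h.some.lam ξ) / 2) with hg
  have hd : ∀ t ∈ Icc 0 T, MulDom g (h.some.U (f t)) := fun t ht =>
    (norm_mulL2_sq_eq_gevreySq h hφ hj (hf t ht).1).1
  intro t ht
  rw [ContinuousWithinAt, tendsto_iff_norm_sub_tendsto_zero]
  have h1 := (ENNReal.tendsto_toReal ENNReal.zero_ne_top).comp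
    (tendsto_zero_of_gevreyNormSq (hf t ht).2).2
  have h2 := (Real.continuous_sqrt.tendsto 0).comp h1
  rw [Real.sqrt_zero] at h2
  refine h2.congr' ?_
  filter_upwards [self_mem_nhdsWithin] with s hs
  have hds := mulL2_sub (hd s hs) (hd t ht)
  have e : gevreySq A φ r α (f s - f t) =
      ENNReal.ofReal (‖mulL2 g (h.some.U (f s)) - mulL2 g (h.some.U (f t))‖ ^ 2) := by
    rw [gevreySq_eq_lintegral h hj, ← hds.2, norm_mulL2_sq hds.1, map_sub]
  simp only [Function.comp, e]
  rw [ENNReal.toReal_ofReal (sq_nonneg _), Real.sqrt_sq (norm_nonneg _)]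

theorem U_applyOp (h : Nonempty (SpectralRepresentation A)) {u : H}
    (hu : MulDom (fun ξ => h.some.lam ξ ^ 2) (h.some.U u)) :
    h.some.U (applyOp A u) = mulL2 (fun ξ => h.some.lam ξ ^ 2) (h.some.U u) := by
  have hd : u ∈ A.domain := (h.some.mem_domain_iff u).2 hu
  rw [applyOp, dif_pos hd]
  exact ((mulL2_eq (h.some.apply_eq ⟨u, hd⟩)).2).symm

theorem powNormSq_half (h : Nonempty (SpectralRepresentation A)) {u : H}
    (hu : MulDom h.some.lam (h.some.U u)) :
    powNormSq A (1 / 2) u = ‖mulL2 h.some.lam (h.some.U u)‖ ^ 2 := by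
  rw [powNormSq, spectralIntegral_eq h, ← ENNReal.toReal_ofReal (sq_nonneg _), norm_mulL2_sq hu]
  congr 1
  refine lintegral_congr fun ξ => ?_
  rw [show 4 * (1 / 2 : ℝ) = ((2 : ℕ) : ℝ) by norm_num, Real.rpow_natCast,
    ← ENNReal.ofReal_mul (sq_nonneg _), mul_pow]

/-- A solution in the Gevrey class, restricted to `[t₀, t₀ + a]` and seen in the spectral
representation. The weight `φ` is replaced by its lower bound `w ∘ κ`, which is measurable and
constant at low frequencies, where powers of `lam` are bounded. -/
theorem SolutionClass.exists_spectralSolution (h : Nonempty (SpectralRepresentation A))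
    {ω φ m : ℝ → ℝ} {ν : ℝ} {κ : ℝ → ℕ} {b w : ℕ → ℝ} (hblocks : FrequencyBlocks ω φ ν κ b w)
    {r T : ℝ} (hr : 0 < r) (hT : 0 < T) {u₀ u₁ : H} {v : ℝ → H} (hv : SolutionClass A φ r T v)
    (hs : IsSolution A m u₀ u₁ T v) :
    ∃ Q, ∀ t₀ a, 0 ≤ t₀ → 0 < a → t₀ + a < T →
      SpectralSolution h.some.μ h.some.lam (fun ξ => w (κ (h.some.lam ξ))) m r a Q
        (fun t => h.some.U (v (t₀ + t))) (fun t => h.some.U (derivWithin v (Icc 0 T) (t₀ + t))) := by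
  obtain ⟨hd1, hd2, hg1, hg2⟩ := hv.regularity hT
  set v' := derivWithin v (Icc 0 T) with hv'
  set R := h.some with hR
  set Φ : ℝ → ℝ := fun l => w (κ l) with hΦ
  have hΦm : Measurable Φ := (measurable_of_countable w).comp hblocks.measurable
  have hm := R.measurable_lam
  have hl0 := R.lam_nonneg
  have g1 : ContGevrey A Φ r (3 / 2) T v := hg1.mono h hblocks.w_le hr.le
  have g2 : ContGevrey A Φ r 1 T v' := hg2.mono h hblocks.w_le hr.le
  set e : R.M → ℝ := fun ξ => Real.exp (r * Φ (R.lam ξ) / 2) with he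
  have hem : Measurable e := (((hΦm.comp hm).const_mul r).div_const 2).exp
  have he1 : ∀ ξ, 1 ≤ e ξ := fun ξ => by
    rw [he]
    refine Real.one_le_exp ?_
    have := hblocks.one_le (κ (R.lam ξ))
    change 0 ≤ r * w (κ (R.lam ξ)) / 2
    positivity
  have hj3 : 4 * (3 / 2 : ℝ) = ((2 * 3 : ℕ) : ℝ) := by norm_num
  have hj2 : 4 * (1 : ℝ) = ((2 * 2 : ℕ) : ℝ) := by norm_num
  have cx : ContinuousOn (fun t => R.U (v t)) (Icc 0 T) :=
    R.U.continuous.comp_continuousOn g1.continuousOn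
  have cp : ContinuousOn (fun t => R.U (v' t)) (Icc 0 T) :=
    R.U.continuous.comp_continuousOn g2.continuousOn
  have dx : ∀ t ∈ Icc 0 T, MulDom (fun ξ => R.lam ξ ^ 3 * e ξ) (R.U (v t)) := fun t ht =>
    (norm_mulL2_sq_eq_gevreySq h hΦm hj3 (g1 t ht).1).1
  have dp : ∀ t ∈ Icc 0 T, MulDom (fun ξ => R.lam ξ ^ 2 * e ξ) (R.U (v' t)) := fun t ht =>
    (norm_mulL2_sq_eq_gevreySq h hΦm hj2 (g2 t ht).1).1
  have cex : ContinuousOn (fun t => mulL2 (fun ξ => R.lam ξ ^ 3 * e ξ) (R.U (v t))) (Icc 0 T) :=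
    g1.continuousOn_mulL2 h hΦm hj3
  have cep : ContinuousOn (fun t => mulL2 (fun ξ => R.lam ξ ^ 2 * e ξ) (R.U (v' t))) (Icc 0 T) :=
    g2.continuousOn_mulL2 h hΦm hj2
  obtain ⟨Q₁, hQ₁⟩ := isCompact_Icc.exists_bound_of_continuousOn cx
  obtain ⟨Q₂, hQ₂⟩ := isCompact_Icc.exists_bound_of_continuousOn cp
  obtain ⟨Q₃, hQ₃⟩ := isCompact_Icc.exists_bound_of_continuousOn cex
  obtain ⟨Q₄, hQ₄⟩ := isCompact_Icc.exists_bound_of_continuousOn cep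
  have h0T : (0 : ℝ) ∈ Icc 0 T := left_mem_Icc.2 hT.le
  have Q₁0 : 0 ≤ Q₁ := (norm_nonneg _).trans (hQ₁ 0 h0T)
  have Q₂0 : 0 ≤ Q₂ := (norm_nonneg _).trans (hQ₂ 0 h0T)
  have Q₃0 : 0 ≤ Q₃ := (norm_nonneg _).trans (hQ₃ 0 h0T)
  have Q₄0 : 0 ≤ Q₄ := (norm_nonneg _).trans (hQ₄ 0 h0T)
  obtain ⟨b₀, hb₀, hlow⟩ := hblocks.low
  set E := Real.exp (r / 2) with hE
  have hE0 : 0 < E := Real.exp_pos _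
  have hlow' : ∀ ξ, R.lam ξ ≤ b₀ → e ξ = E := fun ξ hξ => by
    change Real.exp (r * w (κ (R.lam ξ)) / 2) = Real.exp (r / 2)
    rw [hlow _ (hl0 ξ) hξ, mul_one]
  -- pointwise comparison of the weights
  have p1 : ∀ ξ, |R.lam ξ| ≤ 1 * |R.lam ξ ^ 3 * e ξ| + 1 := fun ξ => by
    have h1 := hl0 ξ
    rw [abs_of_nonneg h1, abs_of_nonneg (by have := he1 ξ; positivity), one_mul]
    have h2 : R.lam ξ ^ 3 * 1 ≤ R.lam ξ ^ 3 * e ξ := mul_le_mul_of_nonneg_left (he1 ξ) (by positivity)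
    have h3 : R.lam ξ ≤ R.lam ξ ^ 3 + 1 := by
      nlinarith [mul_nonneg (add_nonneg h1 zero_le_one) (sq_nonneg (R.lam ξ - 1))]
    linarith
  have p2 : ∀ ξ, |R.lam ξ ^ 2| ≤ 1 * |R.lam ξ ^ 3 * e ξ| + 1 := fun ξ => by
    have h1 := hl0 ξ
    rw [abs_of_nonneg (sq_nonneg _), abs_of_nonneg (by have := he1 ξ; positivity), one_mul]
    have h2 : R.lam ξ ^ 3 * 1 ≤ R.lam ξ ^ 3 * e ξ := mul_le_mul_of_nonneg_left (he1 ξ) (by positivity)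
    have h3 : R.lam ξ ^ 2 ≤ R.lam ξ ^ 3 + 1 := by
      nlinarith [mul_nonneg (add_nonneg h1 zero_le_one) (sq_nonneg (R.lam ξ - 1))]
    linarith
  have p3 : ∀ ξ, |R.lam ξ ^ 3| ≤ 1 * |R.lam ξ ^ 3 * e ξ| + 0 := fun ξ => by
    rw [abs_mul, one_mul, add_zero]
    exact le_mul_of_one_le_right (abs_nonneg _) ((he1 ξ).trans (le_abs_self _))
  have p4 : ∀ ξ, |R.lam ξ ^ 2 * e ξ| ≤ 1 / b₀ * |R.lam ξ ^ 3 * e ξ| + b₀ ^ 2 * E := fun ξ => by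
    have h1 := hl0 ξ
    have h2 := he1 ξ
    rw [abs_of_nonneg (by positivity), abs_of_nonneg (by positivity)]
    rcases le_total (R.lam ξ) b₀ with h3 | h3
    · rw [hlow' ξ h3]
      have h4 : R.lam ξ ^ 2 * E ≤ b₀ ^ 2 * E :=
        mul_le_mul_of_nonneg_right (pow_le_pow_left₀ h1 h3 2) hE0.le
      have h5 : 0 ≤ 1 / b₀ * (R.lam ξ ^ 3 * E) := by positivity
      linarith
    · have h4 : R.lam ξ ^ 2 * e ξ * b₀ ≤ R.lam ξ ^ 2 * e ξ * R.lam ξ :=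
        mul_le_mul_of_nonneg_left h3 (by positivity)
      have h5 : R.lam ξ ^ 2 * e ξ ≤ 1 / b₀ * (R.lam ξ ^ 3 * e ξ) := by
        rw [one_div_mul_eq_div, le_div_iff₀ hb₀]
        linarith
      have h6 : 0 ≤ b₀ ^ 2 * E := by positivity
      linarith
  have p5 : ∀ ξ, |R.lam ξ| ≤ 1 * |R.lam ξ ^ 2 * e ξ| + 1 := fun ξ => by
    have h1 := hl0 ξ
    rw [abs_of_nonneg h1, abs_of_nonneg (by have := he1 ξ; positivity), one_mul]
    have h2 : R.lam ξ ^ 2 * 1 ≤ R.lam ξ ^ 2 * e ξ := mul_le_mul_of_nonneg_left (he1 ξ) (by positivity)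
    nlinarith [sq_nonneg (R.lam ξ - 1)]
  have p6 : ∀ ξ, |R.lam ξ ^ 2| ≤ 1 * |R.lam ξ ^ 2 * e ξ| + 0 := fun ξ => by
    rw [abs_mul, one_mul, add_zero]
    exact le_mul_of_one_le_right (abs_nonneg _) ((he1 ξ).trans (le_abs_self _))
  have p7 : ∀ ξ, |R.lam ξ * e ξ| ≤ 1 / b₀ * |R.lam ξ ^ 2 * e ξ| + b₀ * E := fun ξ => by
    have h1 := hl0 ξ
    have h2 := he1 ξ
    rw [abs_of_nonneg (by positivity), abs_of_nonneg (by positivity)]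
    rcases le_total (R.lam ξ) b₀ with h3 | h3
    · rw [hlow' ξ h3]
      have h4 : R.lam ξ * E ≤ b₀ * E := mul_le_mul_of_nonneg_right h3 hE0.le
      have h5 : 0 ≤ 1 / b₀ * (R.lam ξ ^ 2 * E) := by positivity
      linarith
    · have h4 : R.lam ξ * e ξ * b₀ ≤ R.lam ξ * e ξ * R.lam ξ :=
        mul_le_mul_of_nonneg_left h3 (by positivity)
      have h5 : R.lam ξ * e ξ ≤ 1 / b₀ * (R.lam ξ ^ 2 * e ξ) := by
        rw [one_div_mul_eq_div, le_div_iff₀ hb₀]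
        linarith
      have h6 : 0 ≤ b₀ * E := by positivity
      linarith
  have b3 := fun t ht => norm_mulL2_le_of_abs_le (hm.pow_const 3) zero_le_one le_rfl (dx t ht) p3
  have b4 := fun t ht => norm_mulL2_le_of_abs_le ((hm.pow_const 2).mul hem)
    (one_div_nonneg.2 hb₀.le) (by positivity) (dx t ht) p4
  have b6 := fun t ht => norm_mulL2_le_of_abs_le (hm.pow_const 2) zero_le_one le_rfl (dp t ht) p6
  have b7 := fun t ht => norm_mulL2_le_of_abs_le (hm.mul hem)
    (one_div_nonneg.2 hb₀.le) (by positivity) (dp t ht) p7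
  have d1 := fun t ht => (norm_mulL2_le_of_abs_le hm zero_le_one zero_le_one (dx t ht) p1).1
  have d2 := fun t ht =>
    (norm_mulL2_le_of_abs_le (hm.pow_const 2) zero_le_one zero_le_one (dx t ht) p2).1
  have d5 := fun t ht => (norm_mulL2_le_of_abs_le hm zero_le_one zero_le_one (dp t ht) p5).1
  have c2 : ContinuousOn (fun t => mulL2 (fun ξ => R.lam ξ ^ 2) (R.U (v t))) (Icc 0 T) :=
    continuousOn_mulL2_of_abs_le (hm.pow_const 2) zero_le_one zero_le_one p2 cx dx cex
  set Q := Q₃ + (1 / b₀ * Q₃ + b₀ ^ 2 * E * Q₁) + Q₄ + (1 / b₀ * Q₄ + b₀ * E * Q₂) with hQ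
  have q1 : 0 ≤ 1 / b₀ * Q₃ + b₀ ^ 2 * E * Q₁ := by positivity
  have q2 : 0 ≤ 1 / b₀ * Q₄ + b₀ * E * Q₂ := by positivity
  refine ⟨Q, fun t₀ a ht₀ ha hta => ?_⟩
  have hmem : ∀ t ∈ Icc 0 a, t₀ + t ∈ Icc 0 T := fun t ht =>
    ⟨by linarith [ht.1], by linarith [ht.2]⟩
  have hshift : ∀ {f f' : ℝ → H}, (∀ t ∈ Icc 0 T, HasDerivWithinAt f (f' t) (Icc 0 T) t) →
      ∀ t ∈ Icc 0 a, HasDerivWithinAt (fun t => R.U (f (t₀ + t))) (R.U (f' (t₀ + t)))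
        (Icc 0 a) t := fun hf t ht => by
    have h1 : HasDerivWithinAt (fun t => t₀ + t) 1 (Icc 0 a) t :=
      (hasDerivWithinAt_id t _).const_add t₀
    have h2 := (hf _ (hmem t ht)).scomp t h1 (fun s hs => hmem s hs)
    rw [one_smul] at h2
    exact R.U.toContinuousLinearEquiv.toContinuousLinearMap.hasFDerivAt.comp_hasDerivWithinAt t h2
  exact
    { deriv_x := hshift hd1
      deriv_p := fun t ht => by
        have h1 := hshift hd2 t ht
        have h2 := hmem t ht
        have h3 := hs.1 (t₀ + t) ⟨h2.1, by linarith [ht.2]⟩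
        rw [eq_neg_of_add_eq_zero_left h3, ← neg_smul, map_smul, U_applyOp h (d2 _ h2),
          powNormSq_half h (d1 _ h2)] at h1
        exact h1
      continuousOn := c2.comp (by fun_prop) hmem
      dom_x₁ := fun t ht => d1 _ (hmem t ht)
      dom_x₂ := fun t ht => d2 _ (hmem t ht)
      dom_x₃ := fun t ht => (b3 _ (hmem t ht)).1
      dom_p₁ := fun t ht => d5 _ (hmem t ht)
      dom_p₂ := fun t ht => (b6 _ (hmem t ht)).1
      dom_exp_x := fun t ht => (b4 _ (hmem t ht)).1
      dom_exp_p := fun t ht => (b7 _ (hmem t ht)).1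
      norm_x₃ := fun t ht => by
        refine (b3 _ (hmem t ht)).2.trans ?_
        have := hQ₃ _ (hmem t ht)
        linarith
      norm_p₂ := fun t ht => by
        refine (b6 _ (hmem t ht)).2.trans ?_
        have := hQ₄ _ (hmem t ht)
        linarith
      norm_exp_x := fun t ht => by
        refine (b4 _ (hmem t ht)).2.trans ?_
        have h1 := mul_le_mul_of_nonneg_left (hQ₃ _ (hmem t ht)) (one_div_nonneg.2 hb₀.le)
        have h2 := mul_le_mul_of_nonneg_left (hQ₁ _ (hmem t ht)) (a := b₀ ^ 2 * E) (by positivity)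
        linarith
      norm_exp_p := fun t ht => by
        refine (b7 _ (hmem t ht)).2.trans ?_
        have h1 := mul_le_mul_of_nonneg_left (hQ₄ _ (hmem t ht)) (one_div_nonneg.2 hb₀.le)
        have h2 := mul_le_mul_of_nonneg_left (hQ₂ _ (hmem t ht)) (a := b₀ * E) (by positivity)
        linarith }

theorem SpectralSolution.mono {M : Type*} [MeasurableSpace M] {μ : Measure M} {lam Φ : M → ℝ}
    {m : ℝ → ℝ} {r a Q Q' : ℝ} {x p : ℝ → Lp ℝ 2 μ} (h : SpectralSolution μ lam Φ m r a Q x p)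
    (hQ : Q ≤ Q') : SpectralSolution μ lam Φ m r a Q' x p :=
  { h with
    norm_x₃ := fun t ht => (h.norm_x₃ t ht).trans hQ
    norm_p₂ := fun t ht => (h.norm_p₂ t ht).trans hQ
    norm_exp_x := fun t ht => (h.norm_exp_x t ht).trans hQ
    norm_exp_p := fun t ht => (h.norm_exp_p t ht).trans hQ }

/-- Two solutions with the same non-degenerate state at some time coincide for a short time. -/
theorem exists_eqOn_of_nondegeneracy_ne_zero (h : Nonempty (SpectralRepresentation A))
    {ω φ m : ℝ → ℝ} {ν : ℝ} {κ : ℝ → ℕ} {b w : ℕ → ℝ} (hblocks : FrequencyBlocks ω φ ν κ b w)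
    (hω : IsContinuityModulus ω) (hm : IsOmegaContinuous ω m) (hν : 0 ≤ ν)
    (hmν : ∀ s, 0 ≤ s → ν ≤ m s) {r T : ℝ} (hr : 0 < r) {u₀ u₁ : H} {v₁ v₂ : ℝ → H}
    (hv₁_reg : SolutionClass A φ r T v₁) (hv₁ : IsSolution A m u₀ u₁ T v₁)
    (hv₂_reg : SolutionClass A φ r T v₂) (hv₂ : IsSolution A m u₀ u₁ T v₂)
    {t₀ : ℝ} (ht₀ : t₀ ∈ Ico 0 T) (h0 : v₁ t₀ = v₂ t₀)
    (h1 : derivWithin v₁ (Icc 0 T) t₀ = derivWithin v₂ (Icc 0 T) t₀)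
    (hnd : nondegeneracy A m (v₁ t₀) (derivWithin v₁ (Icc 0 T) t₀) ≠ 0) :
    ∃ δ > 0, t₀ + δ ≤ T ∧ ∀ t ∈ Icc t₀ (t₀ + δ), v₁ t = v₂ t := by
  have hT : 0 < T := ht₀.1.trans_lt ht₀.2
  obtain ⟨Q₁, hQ₁⟩ := hv₁_reg.exists_spectralSolution h hblocks hr hT hv₁
  obtain ⟨Q₂, hQ₂⟩ := hv₂_reg.exists_spectralSolution h hblocks hr hT hv₂
  set a := (T - t₀) / 2 with ha
  have ha0 : 0 < a := by
    have := ht₀.2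
    rw [ha]; linarith
  have haT : t₀ + a < T := by
    have := ht₀.2
    rw [ha]; linarith
  have s₁ := (hQ₁ t₀ a ht₀.1 ha0 haT).mono (le_max_left Q₁ Q₂)
  have s₂ := (hQ₂ t₀ a ht₀.1 ha0 haT).mono (le_max_right Q₁ Q₂)
  have hz : (0 : ℝ) ∈ Icc 0 a := left_mem_Icc.2 ha0.le
  have k1 := s₁.dom_x₁ 0 hz
  have k2 := s₁.dom_x₂ 0 hz
  have k3 := s₁.dom_p₁ 0 hz
  simp only [add_zero] at k1 k2 k3
  have hne : firstDeriv h.some.lam (h.some.U (v₁ (t₀ + 0)))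
        (h.some.U (derivWithin v₁ (Icc 0 T) (t₀ + 0))) ≠ 0 ∨
      secondDeriv h.some.lam m (h.some.U (v₁ (t₀ + 0)))
        (h.some.U (derivWithin v₁ (Icc 0 T) (t₀ + 0))) ≠ 0 := by
    rw [add_zero]
    by_contra hcon
    push Not at hcon
    obtain ⟨e1, e2⟩ := hcon
    rw [firstDeriv, ← U_applyOp h k2, LinearIsometryEquiv.inner_map_map] at e1
    rw [secondDeriv, ← U_applyOp h k2, LinearIsometryEquiv.norm_map, ← powNormSq_half h k1,
      ← powNormSq_half h k3] at e2
    refine hnd ?_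
    rw [nondegeneracy, (mul_eq_zero.1 e1).resolve_left two_ne_zero,
      (mul_eq_zero.1 e2).resolve_left two_ne_zero, abs_zero, add_zero]
  obtain ⟨δ, hδ, heq⟩ := SpectralSolution.exists_eqOn hblocks hω hm hν hmν h.some.measurable_lam
    h.some.lam_nonneg hr ha0 s₁ s₂ (by simp only [add_zero, h0]) (by simp only [add_zero, h1]) hne
  refine ⟨δ, hδ.1, by linarith [hδ.2], fun t ht => ?_⟩
  have := heq (t - t₀) ⟨by linarith [ht.1], by linarith [ht.2]⟩
  simp only [add_sub_cancel] at this
  exact h.some.U.injective this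

end Transfer

end Kirchhoff

/-! ### Uniqueness -/

theorem mainTheorem2
    {H : Type*} [NormedAddCommGroup H] [InnerProductSpace ℝ H] [CompleteSpace H]
    [TopologicalSpace.SeparableSpace H]
    (A : H →ₗ.[ℝ] H) (hA_dense : Dense (A.domain : Set H)) (hA_selfAdjoint : IsSelfAdjoint A)
    (hA_nonneg : ∀ u : A.domain, 0 ≤ inner ℝ (A u) (u : H))
    (ω : ℝ → ℝ) (hω : Kirchhoff.IsContinuityModulus ω)
    (m : ℝ → ℝ) (hm_nonneg : ∀ σ, 0 ≤ σ → 0 ≤ m σ) (hm : Kirchhoff.IsOmegaContinuous ω m)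
    (φ : ℝ → ℝ) (hφ : ∀ σ, 0 ≤ σ → 1 ≤ φ σ)
    (Λ : ℝ)
    (hΛ : (0 < Kirchhoff.infimum m ∧ ∀ σ, 0 < σ → σ * ω (1 / σ) ≤ Λ * φ σ) ∨
      (Kirchhoff.infimum m = 0 ∧ ∀ σ, 0 < σ → σ ≤ Λ * φ (σ / Real.sqrt (ω (1 / σ)))))
    (u₀ u₁ : H) (r₀ : ℝ) (hr₀ : 0 < r₀)
    (hu₀ : u₀ ∈ Kirchhoff.gevrey A φ r₀ (3 / 2)) (hu₁ : u₁ ∈ Kirchhoff.gevrey A φ r₀ 1)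
    (hnd : Kirchhoff.nondegeneracy A m u₀ u₁ ≠ 0)
    (T r₁ : ℝ) (hT : 0 < T) (hr₁ : r₁ ∈ Set.Ioo 0 r₀)
    (v₁ v₂ : ℝ → H)
    (hv₁_reg : Kirchhoff.SolutionClass A φ r₁ T v₁) (hv₁ : Kirchhoff.IsSolution A m u₀ u₁ T v₁)
    (hv₂_reg : Kirchhoff.SolutionClass A φ r₁ T v₂) (hv₂ : Kirchhoff.IsSolution A m u₀ u₁ T v₂) :
    (∃ T₁ ∈ Set.Ioc 0 T, ∀ t ∈ Set.Icc 0 T₁, v₁ t = v₂ t) ∧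
    ∀ Tstar : ℝ, Tstar = sSup {T₁ : ℝ | T₁ ∈ Set.Ioc 0 T ∧ ∀ t ∈ Set.Icc 0 T₁, v₁ t = v₂ t} →
      (∀ t ∈ Set.Icc 0 Tstar, v₁ t = v₂ t) ∧
      (Tstar = T ∨
        Kirchhoff.nondegeneracy A m (v₁ Tstar) (derivWithin v₁ (Set.Icc 0 T) Tstar) = 0) := by
  have hR := Kirchhoff.nonempty_spectralRepresentation hu₀
  obtain ⟨ν, κ, b, w, hν, hmν, hblocks⟩ : ∃ ν κ b w, 0 ≤ ν ∧ (∀ s, 0 ≤ s → ν ≤ m s) ∧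
      Kirchhoff.FrequencyBlocks ω φ ν κ b w := by
    rcases hΛ with ⟨h1, h2⟩ | ⟨-, h2⟩
    · obtain ⟨κ, b, w, hb⟩ := Kirchhoff.exists_frequencyBlocks_of_pos hω h1 hφ h2
      refine ⟨_, κ, b, w, h1.le, fun s hs => csInf_le ⟨0, ?_⟩ ⟨s, hs, rfl⟩, hb⟩
      rintro _ ⟨σ, hσ, rfl⟩
      exact hm_nonneg σ hσ
    · obtain ⟨κ, b, w, hb⟩ := Kirchhoff.exists_frequencyBlocks_of_zero hω hφ h2
      exact ⟨0, κ, b, w, le_rfl, hm_nonneg, hb⟩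
  -- uniqueness after any time at which the two solutions have the same non-degenerate state
  have hlocal := fun {t₀ : ℝ} => Kirchhoff.exists_eqOn_of_nondegeneracy_ne_zero (t₀ := t₀) hR
    hblocks hω hm hν hmν hr₁.1 hv₁_reg hv₁ hv₂_reg hv₂
  have hloc0 : ∃ T₁ ∈ Set.Ioc 0 T, ∀ t ∈ Set.Icc 0 T₁, v₁ t = v₂ t := by
    obtain ⟨δ, hδ, hδT, heq⟩ := hlocal (t₀ := 0) ⟨le_rfl, hT⟩ (hv₁.2.1.trans hv₂.2.1.symm)
      (hv₁.2.2.trans hv₂.2.2.symm) (by rwa [hv₁.2.1, hv₁.2.2])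
    rw [zero_add] at hδT heq
    exact ⟨δ, ⟨hδ, hδT⟩, heq⟩
  refine ⟨hloc0, fun Tstar hTstar => ?_⟩
  set S := {T₁ : ℝ | T₁ ∈ Set.Ioc 0 T ∧ ∀ t ∈ Set.Icc 0 T₁, v₁ t = v₂ t} with hS
  have hSne : S.Nonempty := by
    obtain ⟨T₁, h1, h2⟩ := hloc0
    exact ⟨T₁, h1, h2⟩
  have hSb : BddAbove S := ⟨T, fun t ht => ht.1.2⟩
  have hpos : 0 < Tstar := by
    obtain ⟨T₁, h1⟩ := hSne
    rw [hTstar]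
    exact h1.1.1.trans_le (le_csSup hSb h1)
  have hle : Tstar ≤ T := by
    rw [hTstar]
    exact csSup_le hSne fun t ht => ht.1.2
  have hsub : Set.Icc 0 Tstar ⊆ Set.Icc 0 T := Set.Icc_subset_Icc_right hle
  have hmem : Tstar ∈ Set.Icc 0 Tstar := Set.right_mem_Icc.2 hpos.le
  obtain ⟨d₁, -⟩ := hv₁_reg.regularity hT
  obtain ⟨d₂, -⟩ := hv₂_reg.regularity hT
  have hlt : ∀ t ∈ Set.Ico 0 Tstar, v₁ t = v₂ t := fun t ht => by
    obtain ⟨T₁, h1, h2⟩ := exists_lt_of_lt_csSup hSne (hTstar ▸ ht.2)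
    exact h1.2 t ⟨ht.1, h2.le⟩
  have hend : v₁ Tstar = v₂ Tstar := by
    have hsub' : Set.Ico 0 Tstar ⊆ Set.Icc 0 T := Set.Ico_subset_Icc_self.trans hsub
    have c₁ := (d₁ Tstar (hsub hmem)).continuousWithinAt.mono hsub'
    have c₂ := (d₂ Tstar (hsub hmem)).continuousWithinAt.mono hsub'
    have : (𝓝[Set.Ico 0 Tstar] Tstar).NeBot := by
      rw [← mem_closure_iff_nhdsWithin_neBot, closure_Ico hpos.ne]
      exact hmem
    refine tendsto_nhds_unique c₁ (c₂.congr' ?_)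
    filter_upwards [self_mem_nhdsWithin] with t ht using (hlt t ht).symm
  have heq : ∀ t ∈ Set.Icc 0 Tstar, v₁ t = v₂ t := fun t ht => by
    rcases ht.2.lt_or_eq with h1 | h1
    · exact hlt t ⟨ht.1, h1⟩
    · rw [h1, hend]
  refine ⟨heq, ?_⟩
  by_contra hcon
  push Not at hcon
  obtain ⟨hne, hnd'⟩ := hcon
  have hd : derivWithin v₁ (Set.Icc 0 T) Tstar = derivWithin v₂ (Set.Icc 0 T) Tstar :=
    (uniqueDiffOn_Icc hpos Tstar hmem).eq_deriv _ ((d₁ Tstar (hsub hmem)).mono hsub)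
      (((d₂ Tstar (hsub hmem)).mono hsub).congr_of_mem heq hmem)
  obtain ⟨δ, hδ, hδT, heq'⟩ := hlocal ⟨hpos.le, lt_of_le_of_ne hle hne⟩ hend hd hnd'
  have hin : Tstar + δ ∈ S := ⟨⟨by linarith, hδT⟩, fun t ht => by
    rcases le_total t Tstar with h1 | h1
    · exact heq t ⟨ht.1, h1⟩
    · exact heq' t ⟨h1, ht.2⟩⟩
  have := le_csSup hSb hin
  rw [← hTstar] at this
  linarith
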